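/- **Theorem.** A conjunctive query without self-joins $Q(\mathbf A):-R_1(\mathbb A_1),\dots,R_m(\mathbb A_m)$ has distinct relation symbols $R_i$ over finite attribute sets $\mathbb A_i$ and a set of output attributes $\mathbf A\subseteq \mathbb A:=\bigcup_i \mathbb A_i$. A database $D$ for $Q$ consists of a finite set $R_i^D$ of tuples over $\mathbb A_i$ for every $i$; its size is $N=|D|=\sum_i |R_i^D|$; and $Q(D)$ is the projection onto $\mathbf A$ of the natural join $R_1^D\Join\cdots\Join R_m^D$. A witness for $D$ is a sub-database $D'\subseteq D$ with $Q(D')=Q(D)$. A smallest witness is a witness $D^*$ of minimum size $|D^*|$. Let $Q$ be a conjunctive query without self-joins that has exactly one non-output attribute, i.e. $|\mathbb A\setminus\mathbf A|=1$ (for example, a star query $Q(A_1,\dots,A_m):-R_1(A_1,B),\dots,R_m(A_m,B)$). Then the smallest witness problem for $Q$ is $O(\log N)$-approximable in polynomial time: there are a function $\theta$ with $\theta(N)=O(\log N)$ as $N\to\infty$ and an algorithm that, for every database $D$ for $Q$ with $N=|D|$, computes in time polynomial in $N$ a witness $D'$ for $D$ with $|D'|\le\theta(N)\cdot|D^*|$,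 where $D^*$ is a smallest witness for $D$. Here $Q$ is fixed, so $\theta$, the algorithm and the polynomial may depend on $Q$ (data complexity), attribute values are natural numbers, and time is the number of steps of a random access machine on which copying, addition, truncated subtraction, testing for zero, and reading or writing a memory cell are single steps. -/

import Mathlib

open Filter Asymptotics

/-- A conjunctive query without self-joins
`Q(head) :- R_0(attr 0), ..., R_{numRels-1}(attr (numRels-1))`.
Attributes are named by natural numbers. The relation symbols are the (distinct) indices
`i : Fin numRels`; different symbols may have equal attribute sets. -/
structure CQ where
  /-- the number of relations in the body -/
  numRels : ℕ
  /-- the attributes of each relation -/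
  attr : Fin numRels → Finset ℕ
  /-- the output attributes -/
  head : Finset ℕ
  /-- the output attributes appear in the body -/
  head_subset : head ⊆ Finset.univ.biUnion attr

namespace CQ

/-- All attributes that appear in the body of the query. -/
def attrs (Q : CQ) : Finset ℕ := Finset.univ.biUnion Q.attr

/-- The non-output (existential) attributes. -/
def nonOutput (Q : CQ) : Finset ℕ := Q.attrs \ Q.head

/-- A tuple over a set of attributes; the values are natural numbers. -/
abbrev Tuple (X : Finset ℕ) : Type := X → ℕ

/-- The projection of a tuple onto a subset of its attributes. -/
def proj {X Y : Finset ℕ} (h : Y ⊆ X) (t : Tuple X) : Tuple Y := fun a => t ⟨a.1, h a.2⟩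

theorem attr_subset_attrs (Q : CQ) (i : Fin Q.numRels) : Q.attr i ⊆ Q.attrs :=
  Finset.subset_biUnion_of_mem Q.attr (Finset.mem_univ i)

theorem head_subset_attrs (Q : CQ) : Q.head ⊆ Q.attrs := Q.head_subset

/-- A database for `Q`: a finite set of tuples for each relation. -/
abbrev Database (Q : CQ) : Type := (i : Fin Q.numRels) → Finset (Tuple (Q.attr i))

/-- The number of tuples of a database (the input size `N`). -/
def Database.size {Q : CQ} (D : Q.Database) : ℕ := ∑ i, (D i).card

/-- The natural join of all relations. -/
def join (Q : CQ) (D : Q.Database) : Set (Tuple Q.attrs) :=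
  {s | ∀ i, proj (Q.attr_subset_attrs i) s ∈ D i}

/-- The query result `Q(D)`: the projection of the natural join onto the output attributes. -/
def result (Q : CQ) (D : Q.Database) : Set (Tuple Q.head) :=
  proj Q.head_subset_attrs '' Q.join D

/-- `D'` is a witness for `D`: a sub-database with the same query result. -/
def IsWitness (Q : CQ) (D D' : Q.Database) : Prop :=
  (∀ i, D' i ⊆ D i) ∧ Q.result D' = Q.result D

/-- `D'` is a solution to the smallest witness problem on `D`. -/
def IsSmallestWitness (Q : CQ) (D D' : Q.Database) : Prop :=
  Q.IsWitness D D' ∧ ∀ D'' : Q.Database, Q.IsWitness D D'' → D'.size ≤ D''.size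

/-- `D'` is a `θ`-approximated solution to the smallest witness problem on `D`. -/
def IsApproxSmallestWitness (Q : CQ) (θ : ℝ) (D D' : Q.Database) : Prop :=
  Q.IsWitness D D' ∧
    ∀ Dstar : Q.Database, Q.IsSmallestWitness D Dstar → (D'.size : ℝ) ≤ θ * (Dstar.size : ℝ)

end CQ

/-! A random access machine with uniform cost. It has registers and arrays (both indexed by
natural numbers; a program only names finitely many of them), all of whose cells hold natural
numbers. The arithmetic operations are addition and truncated subtraction; multiplication is
deliberately not a unit-cost operation, so that polynomially many steps are polynomial time also
on a Turing machine. -/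
namespace RAM

/-- Memory contents: `reg x` is register `x`, and `mem a p` is cell `p` of array `a`. -/
structure State where
  /-- the registers -/
  reg : ℕ → ℕ
  /-- the arrays -/
  mem : ℕ → ℕ → ℕ

/-- `r_x := v` -/
def State.setReg (s : State) (x v : ℕ) : State :=
  { s with reg := Function.update s.reg x v }

/-- `M_a[p] := v` -/
def State.setMem (s : State) (a p v : ℕ) : State :=
  { s with mem := Function.update s.mem a (Function.update (s.mem a) p v) }

/-- Programs. -/
inductive Prog : Type
  /-- do nothing -/
  | skip : Prog
  /-- `r_x := c` for a constant `c` -/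
  | const (x c : ℕ) : Prog
  /-- `r_x := r_y` -/
  | move (x y : ℕ) : Prog
  /-- `r_x := r_y + r_z` -/
  | add (x y z : ℕ) : Prog
  /-- `r_x := r_y - r_z`, which is `0` if `r_y ≤ r_z` -/
  | sub (x y z : ℕ) : Prog
  /-- `r_x := M_a[r_y]` -/
  | load (x a y : ℕ) : Prog
  /-- `M_a[r_y] := r_x` -/
  | store (a y x : ℕ) : Prog
  /-- `P; P'` -/
  | seq (P P' : Prog) : Prog
  /-- if `r_x ≠ 0` then `P` else `P'` -/
  | ifNZ (x : ℕ) (P P' : Prog) : Prog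
  /-- while `r_x ≠ 0` do `P` -/
  | whileNZ (x : ℕ) (P : Prog) : Prog

/-- `Exec P s n s'`: started in the memory `s`, the program `P` halts after exactly `n` steps with
the memory `s'`. Every elementary instruction and every test of a register is one step. -/
inductive Exec : Prog → State → ℕ → State → Prop
  | skip (s : State) : Exec .skip s 1 s
  | const (s : State) (x c : ℕ) : Exec (.const x c) s 1 (s.setReg x c)
  | move (s : State) (x y : ℕ) : Exec (.move x y) s 1 (s.setReg x (s.reg y))
  | add (s : State) (x y z : ℕ) : Exec (.add x y z) s 1 (s.setReg x (s.reg y + s.reg z))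
  | sub (s : State) (x y z : ℕ) : Exec (.sub x y z) s 1 (s.setReg x (s.reg y - s.reg z))
  | load (s : State) (x a y : ℕ) : Exec (.load x a y) s 1 (s.setReg x (s.mem a (s.reg y)))
  | store (s : State) (a y x : ℕ) : Exec (.store a y x) s 1 (s.setMem a (s.reg y) (s.reg x))
  | seq {P P' : Prog} {s s' s'' : State} {n n' : ℕ} :
      Exec P s n s' → Exec P' s' n' s'' → Exec (.seq P P') s (n + n') s''
  | ifTrue {x : ℕ} {P P' : Prog} {s s' : State} {n : ℕ} :
      s.reg x ≠ 0 → Exec P s n s' → Exec (.ifNZ x P P') s (n + 1) s'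
  | ifFalse {x : ℕ} {P P' : Prog} {s s' : State} {n : ℕ} :
      s.reg x = 0 → Exec P' s n s' → Exec (.ifNZ x P P') s (n + 1) s'
  | whileTrue {x : ℕ} {P : Prog} {s s' s'' : State} {n n' : ℕ} :
      s.reg x ≠ 0 → Exec P s n s' → Exec (.whileNZ x P) s' n' s'' →
        Exec (.whileNZ x P) s (n + n' + 1) s''
  | whileFalse {x : ℕ} {P : Prog} {s : State} :
      s.reg x = 0 → Exec (.whileNZ x P) s 1 s

end RAM

namespace CQ

/-- A table for each relation: the rows of the relation, listed in some order. -/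
abbrev Tables (Q : CQ) : Type := (i : Fin Q.numRels) → List (Tuple (Q.attr i))

/-- The tables list every tuple of the database exactly once. -/
def Lists (Q : CQ) (T : Q.Tables) (D : Q.Database) : Prop :=
  ∀ i, (T i).Nodup ∧ (T i).toFinset = D i

/-- The values of a tuple, with the attributes in increasing order. -/
def row {X : Finset ℕ} (t : Tuple X) : List ℕ :=
  List.ofFn fun c : Fin X.card => t (X.orderIsoOfFin rfl c)

/-- The values of a table, row after row. -/
def cells {X : Finset ℕ} (l : List (Tuple X)) : List ℕ := l.flatMap row

/-- The initial memory of the machine on given input tables: register `i` holds the number of rows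
of relation `i`, array `i` holds these rows one after the other, all other cells are `0`. -/
def inputState (Q : CQ) (T : Q.Tables) : RAM.State where
  reg x := if h : x < Q.numRels then (T ⟨x, h⟩).length else 0
  mem a p := if h : a < Q.numRels then (cells (T ⟨a, h⟩)).getD p 0 else 0

/-- The memory `s` contains the tables `T` as output, in the format of the input; the other cells
are arbitrary. -/
def Outputs (Q : CQ) (s : RAM.State) (T : Q.Tables) : Prop :=
  ∀ i : Fin Q.numRels, s.reg i = (T i).length ∧
    ∀ p < (cells (T i)).length, s.mem i p = (cells (T i)).getD p 0

/-- The smallest witness problem is `θ`-approximable for `Q`, where `θ` may depend on the input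
size: a fixed program computes, from each database `D` with `N` tuples (listed in any order), a
`θ N`-approximated solution, in a number of steps that is polynomial in `N`. -/
def SWPApproximable (Q : CQ) (θ : ℕ → ℝ) : Prop :=
  ∃ (P : RAM.Prog) (p : Polynomial ℕ), ∀ (D : Q.Database) (T : Q.Tables), Q.Lists T D →
    ∃ (n : ℕ) (s : RAM.State) (D' : Q.Database) (T' : Q.Tables),
      RAM.Exec P (Q.inputState T) n s ∧ n ≤ p.eval D.size ∧
      Q.Outputs s T' ∧ Q.Lists T' D' ∧ Q.IsApproxSmallestWitness (θ D.size) D D'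

end CQ

/-! Let `β` be the non-output attribute. An element of the join is determined by its output and its
value at `β`. So the join is a hypergraph on the rows that have a value at `β`, in which all ends
of an edge have the same colour (their value at `β`) and two edges of the same colour have
different outputs. A witness is a set of rows that contains all ends of some edge for each output.

For decreasing `d`, while the hypergraph of the uncovered outputs has a non-empty `d`-core, the
rows of one colour in the core are chosen: `a` rows, of degree at least `d`, that cover at least
`a * d / k` new outputs if there are `k` relations. Once the `(d + 1)`-core is empty, at most
`d * r` edges remain inside any `r` rows, hence inside an optimal solution; so at most `d * r`
outputs are uncovered when the cost of `k / d` rows for each new output is paid. As for set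
cover, this adds up to at most `k * r * H_M` rows, where `H_M` is the harmonic number of the number
of outputs. A relation without `β` needs no choice: each of its rows that takes part in the join
belongs to every witness.

The algorithm is executable in polynomial time because the `d`-core can be found by peeling off
rows of small degree, and because, for a fixed query, every test and every count in it ranges over
boundedly many nested loops. The functions that can be evaluated in this way are closed under
arithmetic, bounded search, bounded sums, comprehension of sets of rows and bounded iteration. -/

namespace RAM

section Runs

/-- Started in the memory `s`, the program `P` halts after at most `b` steps with a memory that
satisfies `φ`. -/
def Runs (P : Prog) (s : State) (b : ℕ) (φ : State → Prop) : Prop :=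
  ∃ n s', Exec P s n s' ∧ n ≤ b ∧ φ s'

/-- The registers in `R` and the arrays in `A` have the same contents in `s'` as in `s`. -/
structure Agree (R A : Set ℕ) (s s' : State) : Prop where
  reg : Set.EqOn s'.reg s.reg R
  mem : Set.EqOn s'.mem s.mem A

variable {P P' : Prog} {s s' s'' : State} {R R' A A' : Set ℕ} {b b' : ℕ} {φ ψ : State → Prop}

theorem Exec.runs {n : ℕ} (h : Exec P s n s') (hφ : φ s') : Runs P s n φ :=
  ⟨n, s', h, le_rfl, hφ⟩

theorem Runs.mono (h : Runs P s b φ) (hb : b ≤ b') (hφ : ∀ s', φ s' → ψ s') :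
    Runs P s b' ψ := by
  obtain ⟨n, s', hx, hn, hs'⟩ := h
  exact ⟨n, s', hx, hn.trans hb, hφ s' hs'⟩

theorem Runs.seq (h : Runs P s b φ) (h' : ∀ s', φ s' → Runs P' s' b' ψ) :
    Runs (.seq P P') s (b + b') ψ := by
  obtain ⟨n, s', hx, hn, hs'⟩ := h
  obtain ⟨n', s'', hx', hn', hs''⟩ := h' s' hs'
  exact ⟨_, s'', hx.seq hx', add_le_add hn hn', hs''⟩

theorem Runs.ifNZ {x : ℕ} (h : s.reg x ≠ 0 → Runs P s b φ) (h' : s.reg x = 0 → Runs P' s b' φ) :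
    Runs (.ifNZ x P P') s (b + b' + 1) φ := by
  by_cases hx : s.reg x = 0
  · obtain ⟨n, s', he, hn, hs'⟩ := h' hx
    exact ⟨_, s', .ifFalse hx he, by omega, hs'⟩
  · obtain ⟨n, s', he, hn, hs'⟩ := h hx
    exact ⟨_, s', .ifTrue hx he, by omega, hs'⟩

theorem Runs.whileNZ {x : ℕ} {φ : ℕ → State → Prop} (hzero : ∀ s, φ 0 s → s.reg x = 0)
    (hsucc : ∀ r s, φ (r + 1) s → s.reg x ≠ 0 ∧ Runs P s b (φ r)) {r : ℕ} (hs : φ r s) :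
    Runs (.whileNZ x P) s (r * (b + 1) + 1) (φ 0) := by
  induction r generalizing s with
  | zero => exact ⟨1, s, .whileFalse (hzero s hs), by omega, hs⟩
  | succ r ih =>
    obtain ⟨hx, n, s', he, hn, hs'⟩ := hsucc r s hs
    obtain ⟨n', s'', he', hn', hs''⟩ := ih hs'
    exact ⟨_, s'', .whileTrue hx he he', by rw [Nat.succ_mul]; omega, hs''⟩

theorem Agree.refl (R A : Set ℕ) (s : State) : Agree R A s s :=
  ⟨Set.eqOn_refl _ _, Set.eqOn_refl _ _⟩

theorem Agree.trans (h : Agree R A s s') (h' : Agree R A s' s'') : Agree R A s s'' :=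
  ⟨h'.reg.trans h.reg, h'.mem.trans h.mem⟩

theorem Agree.mono (h : Agree R' A' s s') (hR : R ⊆ R') (hA : A ⊆ A') : Agree R A s s' :=
  ⟨h.reg.mono hR, h.mem.mono hA⟩

theorem agree_setReg {x : ℕ} (hx : x ∉ R) (v : ℕ) : Agree R A s (s.setReg x v) :=
  ⟨fun _ hz => Function.update_of_ne (ne_of_mem_of_not_mem hz hx) _ _, Set.eqOn_refl _ _⟩

theorem agree_setMem {a : ℕ} (ha : a ∉ A) (p v : ℕ) : Agree R A s (s.setMem a p v) :=
  ⟨Set.eqOn_refl _ _, fun _ hz => Function.update_of_ne (ne_of_mem_of_not_mem hz ha) _ _⟩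

theorem State.setReg_reg (s : State) (x v z : ℕ) :
    (s.setReg x v).reg z = if z = x then v else s.reg z :=
  Function.update_apply ..

/-- Run `P` as many times as register `d` says. Register `d` counts the remaining rounds down,
register `d + 1` counts the finished rounds up, and register `d + 2` holds the constant `1`. -/
def countLoop (d : ℕ) (P : Prog) : Prog :=
  .seq (.const (d + 1) 0) (.seq (.const (d + 2) 1) (.whileNZ d
    (.seq P (.seq (.add (d + 1) (d + 1) (d + 2)) (.sub d d (d + 2))))))

theorem Runs.countLoop {d n : ℕ} {φ : ℕ → State → Prop}
    (hφ : ∀ {j s s'}, Agree (Set.Iio d) Set.univ s s' → φ j s → φ j s')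
    (hP : ∀ j t, j < n → t.reg (d + 1) = j → φ j t →
      Runs P t b fun t' => φ (j + 1) t' ∧ Set.EqOn t'.reg t.reg (Set.Ico d (d + 3)))
    (hn : s.reg d = n) (hs : φ 0 s) : Runs (countLoop d P) s (n * (b + 3) + 3) (φ n) := by
  subst hn
  let inv (r : ℕ) (t : State) : Prop := r ≤ s.reg d ∧ φ (s.reg d - r) t ∧
    t.reg d = r ∧ t.reg (d + 1) = s.reg d - r ∧ t.reg (d + 2) = 1
  have hround (r : ℕ) (t : State) (ht : inv (r + 1) t) : t.reg d ≠ 0 ∧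
      Runs (.seq P (.seq (.add (d + 1) (d + 1) (d + 2)) (.sub d d (d + 2)))) t (b + 2)
        (inv r) := by
    obtain ⟨hr, hφt, hd, hd1, hd2⟩ := ht
    refine ⟨by omega, (hP _ t (by omega) hd1 hφt).seq fun t' ⟨hφt', ht'⟩ =>
      (Exec.seq (.add _ _ _ _) (.sub _ _ _ _)).runs ⟨by omega, ?_, ?_⟩⟩
    · rw [show s.reg d - r = s.reg d - (r + 1) + 1 by omega]
      exact hφ ((agree_setReg (by simp) _).trans (agree_setReg (by simp) _)) hφt'
    · have hremaining : t'.reg d = t.reg d := ht' (by simp)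
      have hfinished : t'.reg (d + 1) = t.reg (d + 1) := ht' (by simp)
      have hone : t'.reg (d + 2) = t.reg (d + 2) := ht' (by simp)
      simp only [State.setReg_reg, ↓reduceIte, Nat.left_eq_add, one_ne_zero,
        Nat.add_left_cancel_iff, OfNat.ofNat_ne_one, Nat.add_eq_left, OfNat.ofNat_ne_zero]
      omega
  refine ((Exec.const s (d + 1) 0).runs rfl |>.seq fun t ht =>
    (Exec.const t (d + 2) 1).runs rfl |>.seq fun t' ht' =>
      Runs.whileNZ (φ := inv) (fun t ht => ht.2.2.1) hround (r := s.reg d) ?_).mono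
    (by rw [add_assoc b]; omega) fun t ht => by simpa using ht.2.1
  subst ht ht'
  refine ⟨le_rfl, ?_, by simp [State.setReg_reg]⟩
  rw [Nat.sub_self]
  exact hφ ((agree_setReg (by simp) _).trans (agree_setReg (by simp) _)) hs

end Runs

section Layout

/-- The data of a computation on `k` tables, read from the memory: `size` is the content of
register `k`, which also limits the number of rows that are looked at; `len i` is the content of
register `i`, and `data i` that of array `i`. -/
@[ext] structure Input (k : ℕ) where
  /-- the common limit of all loops -/
  size : ℕ
  /-- the number of rows of each table -/
  len : Fin k → ℕ
  /-- the values of each table, row after row -/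
  data : Fin k → ℕ → ℕ

/-- A set of rows of `k` tables: `(i, j)` is row `j` of table `i`. -/
abbrev Rows (k : ℕ) : Type := Finset (Fin k × ℕ)

variable {k : ℕ} {ι ι' κ κ' : Type} {α : Type*}

/-- The rows below the loop limit. -/
def Input.rows (I : Input k) : Rows k := Finset.univ ×ˢ Finset.range I.size

theorem Input.mem_rows {I : Input k} {v : Fin k × ℕ} : v ∈ I.rows ↔ v.2 < I.size := by
  simp [Input.rows]

/-- The input that the memory holds. -/
def State.input (k : ℕ) (s : State) : Input k := ⟨s.reg k, fun i => s.reg i, fun i => s.mem i⟩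

/-- The place of a row in the numbering of the rows of all tables in which row `(i, j)` comes
before row `(i', j')` if `j < j'`, or if `j = j'` and `i < i'`. -/
def cell (v : Fin k × ℕ) : ℕ := v.2 * k + v.1

theorem cell_injective : Function.Injective (cell : Fin k × ℕ → ℕ) := by
  rintro ⟨i, j⟩ ⟨i', j'⟩ h
  have hj (i : Fin k) (j : ℕ) : (j * k + i) / k = j := by
    rw [mul_comm, Nat.mul_add_div i.pos, Nat.div_eq_of_lt i.2, add_zero]
  have hjj : j = j' := by rw [← hj i j, ← hj i' j']; exact congrArg (· / k) h
  subst hjj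
  exact Prod.ext (Fin.ext (Nat.add_left_cancel h)) rfl

theorem update_cell_eq_ite {f : Fin k × ℕ → ℕ} {m m' : ℕ → ℕ} {i : Fin k} {j : ℕ}
    (h : ∀ v, m' (cell v) = if v.1 = i ∧ v.2 < j then f v else m (cell v)) (v : Fin k × ℕ) :
    Function.update m' (cell (i, j)) (f (i, j)) (cell v) =
      if v.1 = i ∧ v.2 < j + 1 then f v else m (cell v) := by
  obtain ⟨i', j'⟩ := v
  simp only [Function.update_apply, cell_injective.eq_iff, h, Prod.mk.injEq]
  by_cases hi : i' = i
  · subst hi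
    by_cases hj : j' = j
    · simp [hj]
    · simp [hj, Nat.lt_iff_le_and_ne]
  · simp [hi]

/-- The set of rows that array `a` marks, by nonzero values in the cells of the rows. -/
def State.marked (k : ℕ) (s : State) (a : ℕ) : Rows k :=
  (s.input k).rows.filter fun v => s.mem a (cell v) ≠ 0

theorem State.mem_marked {s : State} {a : ℕ} {v : Fin k × ℕ} :
    v ∈ s.marked k a ↔ v.2 < s.reg k ∧ s.mem a (cell v) ≠ 0 := by
  rw [State.marked, Finset.mem_filter, Input.mem_rows, State.input]

theorem State.marked_subset (s : State) (a : ℕ) : s.marked k a ⊆ (s.input k).rows :=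
  Finset.filter_subset _ _

theorem Agree.marked {s s' : State} {R A : Set ℕ}
    (h : Agree R A s s') (hk : k ∈ R) {a : ℕ} (ha : a ∈ A) :
    s'.marked k a = s.marked k a := by
  simp only [State.marked, State.input, Input.rows, h.reg hk, h.mem ha]

/-- A place for numbers `ι` (in registers) and for sets of rows `κ` (in arrays) outside of the
input. The registers from `reg` on and the arrays that are not in `arrays` are free. -/
structure Layout (k : ℕ) (ι κ : Type) where
  /-- the register of each number -/
  num : ι → ℕ
  /-- the array of each set of rows -/
  set : κ → ℕ
  /-- the first free register -/
  reg : ℕ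
  /-- the arrays in use -/
  arrays : Finset ℕ
  lt_num : ∀ i, k < num i
  num_lt : ∀ i, num i < reg
  le_set : ∀ c, k ≤ set c
  set_mem : ∀ c, set c ∈ arrays
  lt_reg : k < reg
  mem_arrays : ∀ i < k, i ∈ arrays

namespace Layout

variable {s s' : State} {ℓ : Layout k ι κ}

/-- The value of `f` on the memory `s`. -/
def eval (ℓ : Layout k ι κ) (f : Input k → (ι → ℕ) → (κ → Rows k) → α) (s : State) : α :=
  f (s.input k) (fun i => s.reg (ℓ.num i)) fun c => s.marked k (ℓ.set c)

/-- The registers and arrays in use have the same contents in `s'` as in `s`. -/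
def Keeps (ℓ : Layout k ι κ) : State → State → Prop := Agree (Set.Iio ℓ.reg) ℓ.arrays

theorem Keeps.size (h : ℓ.Keeps s s') : s'.reg k = s.reg k := h.reg ℓ.lt_reg

theorem Keeps.input (h : ℓ.Keeps s s') : s'.input k = s.input k := by
  have hlen (i : Fin k) : s'.reg i = s.reg i := h.reg (i.2.trans ℓ.lt_reg)
  have hdata (i : Fin k) : s'.mem i = s.mem i := h.mem (ℓ.mem_arrays i i.2)
  simp only [State.input, h.size, hlen, hdata]

theorem Keeps.eval (h : ℓ.Keeps s s') (f : Input k → (ι → ℕ) → (κ → Rows k) → α) :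
    ℓ.eval f s' = ℓ.eval f s := by
  have hnum (i : ι) : s'.reg (ℓ.num i) = s.reg (ℓ.num i) := h.reg (ℓ.num_lt i)
  have hset (c : κ) : s'.marked k (ℓ.set c) = s.marked k (ℓ.set c) :=
    Agree.marked h ℓ.lt_reg (ℓ.set_mem c)
  simp only [Layout.eval, h.input, hnum, hset]

/-- Reserve the next `d` registers. -/
def raise (ℓ : Layout k ι κ) (d : ℕ) : Layout k ι κ where
  __ := ℓ
  reg := ℓ.reg + d
  num_lt i := (ℓ.num_lt i).trans_le (Nat.le_add_right _ _)
  lt_reg := ℓ.lt_reg.trans_le (Nat.le_add_right _ _)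

/-- Reserve the next `d` registers, and keep one more number in the first but `x` of them. -/
def bindNum (ℓ : Layout k ι κ) (x d : ℕ) (hx : x < d) : Layout k (Option ι) κ where
  __ := ℓ.raise d
  num o := o.elim (ℓ.reg + x) ℓ.num
  lt_num := by rintro (_ | i); exacts [ℓ.lt_reg.trans_le (Nat.le_add_right _ _), ℓ.lt_num i]
  num_lt := by rintro (_ | i); exacts [Nat.add_lt_add_left hx _, (ℓ.raise d).num_lt i]

/-- Keep one more set of rows, in the array `a`. -/
def bindSet (ℓ : Layout k ι κ) (a : ℕ) (ha : k ≤ a) : Layout k ι (Option κ) where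
  __ := ℓ
  set o := o.elim a ℓ.set
  arrays := insert a ℓ.arrays
  le_set := by rintro (_ | c); exacts [ha, ℓ.le_set c]
  set_mem := by
    rintro (_ | c)
    exacts [Finset.mem_insert_self _ _, Finset.mem_insert_of_mem (ℓ.set_mem c)]
  mem_arrays i hi := Finset.mem_insert_of_mem (ℓ.mem_arrays i hi)

/-- Rename the numbers and the sets of rows. -/
def comap (ℓ : Layout k ι' κ') (ρ : ι → ι') (τ : κ → κ') : Layout k ι κ where
  __ := ℓ
  num i := ℓ.num (ρ i)
  set c := ℓ.set (τ c)
  lt_num i := ℓ.lt_num (ρ i)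
  num_lt i := ℓ.num_lt (ρ i)
  le_set c := ℓ.le_set (τ c)
  set_mem c := ℓ.set_mem (τ c)

theorem Keeps.of_raise {d : ℕ} (h : (ℓ.raise d).Keeps s s') : ℓ.Keeps s s' :=
  h.mono (Set.Iio_subset_Iio (Nat.le_add_right _ _)) subset_rfl

theorem Keeps.of_bindSet {a : ℕ} {ha : k ≤ a} (h : (ℓ.bindSet a ha).Keeps s s') : ℓ.Keeps s s' :=
  h.mono subset_rfl (Finset.coe_subset.2 (Finset.subset_insert _ _))

theorem le_of_notMem_arrays {a : ℕ} (ha : a ∉ ℓ.arrays) : k ≤ a :=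
  not_lt.1 fun h => ha (ℓ.mem_arrays a h)

theorem keeps_setReg {x : ℕ} (hx : ℓ.reg ≤ x) (v : ℕ) : ℓ.Keeps s (s.setReg x v) :=
  agree_setReg (by simpa using hx) v

end Layout

end Layout

section PolyNum

variable {k : ℕ} {ι ι' κ κ' : Type}

/-- The number `f` is computable in a number of steps that is polynomial in the loop limit. -/
def PolyNum (f : Input k → (ι → ℕ) → (κ → Rows k) → ℕ) : Prop :=
  ∀ ℓ : Layout k ι κ, ∃ (P : Prog) (p : Polynomial ℕ), ∀ s, Runs P s (p.eval (s.reg k))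
    fun s' => ℓ.Keeps s s' ∧ s'.reg ℓ.reg = ℓ.eval f s

open Classical in
/-- The predicate `p` is decidable in a number of steps that is polynomial in the loop limit. -/
def PolyPred (p : Input k → (ι → ℕ) → (κ → Rows k) → Prop) : Prop :=
  PolyNum fun I y X => if p I y X then 1 else 0

namespace PolyNum

theorem of_exec {f : Input k → (ι → ℕ) → (κ → Rows k) → ℕ}
    (h : ∀ ℓ : Layout k ι κ, ∃ P, ∀ s, Exec P s 1 (s.setReg ℓ.reg (ℓ.eval f s))) :
    PolyNum f := fun ℓ => by
  obtain ⟨P, hP⟩ := h ℓ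
  refine ⟨P, 1, fun s => ((hP s).runs ⟨Layout.keeps_setReg le_rfl _, ?_⟩).mono
    (Polynomial.eval_one).ge fun _ => id⟩
  simp [State.setReg_reg]

theorem const (c : ℕ) : PolyNum fun (_ : Input k) (_ : ι → ℕ) (_ : κ → Rows k) => c :=
  of_exec fun _ => ⟨_, fun s => .const s _ c⟩

theorem num (i : ι) : PolyNum fun (_ : Input k) y (_ : κ → Rows k) => y i :=
  of_exec fun ℓ => ⟨_, fun s => .move s _ (ℓ.num i)⟩

theorem size : PolyNum fun (I : Input k) (_ : ι → ℕ) (_ : κ → Rows k) => I.size :=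
  of_exec fun _ => ⟨_, fun s => .move s _ k⟩

theorem len (i : Fin k) : PolyNum fun I (_ : ι → ℕ) (_ : κ → Rows k) => I.len i :=
  of_exec fun _ => ⟨_, fun s => .move s _ i⟩

theorem reindex {f : Input k → (ι → ℕ) → (κ → Rows k) → ℕ} (hf : PolyNum f) (ρ : ι → ι')
    (τ : κ → κ') : PolyNum fun I y X => f I (fun i => y (ρ i)) fun c => X (τ c) :=
  fun ℓ => hf (ℓ.comap ρ τ)

theorem letNum {f : Input k → (ι → ℕ) → (κ → Rows k) → ℕ} (hf : PolyNum f)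
    {g : Input k → (ι → ℕ) → (κ → Rows k) → ℕ → ℕ}
    (hg : PolyNum fun I (y : Option ι → ℕ) X => g I (fun i => y (some i)) X (y none)) :
    PolyNum fun I y X => g I y X (f I y X) := by
  intro ℓ
  obtain ⟨P, p, hP⟩ := hf ℓ
  obtain ⟨P', p', hP'⟩ := hg (ℓ.bindNum 0 1 one_pos)
  refine ⟨.seq P (.seq P' (.move ℓ.reg (ℓ.reg + 1))), p + (p' + 1), fun s =>
    ((hP s).seq (b' := p'.eval (s.reg k) + 1) fun s₁ ⟨hs₁, hv₁⟩ =>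
      ((hP' s₁).mono (by rw [hs₁.size]) fun _ => id).seq fun s₂ ⟨hs₂, hv₂⟩ =>
        (Exec.move s₂ ℓ.reg (ℓ.reg + 1)).runs ⟨?_, ?_⟩).mono (by simp) fun _ => id⟩
  · exact hs₁.trans (hs₂.of_raise.trans (Layout.keeps_setReg le_rfl _))
  · calc _ = s₂.reg (ℓ.reg + 1) := by simp [State.setReg_reg]
      _ = ℓ.eval (fun I y X => g I y X (s₁.reg ℓ.reg)) s₁ := hv₂
      _ = ℓ.eval (fun I y X => g I y X (ℓ.eval f s)) s := by rw [hv₁, hs₁.eval]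

theorem of_instr (op : ℕ → ℕ → ℕ) (instr : ℕ → ℕ → ℕ → Prog)
    (hop : ∀ x y z s, Exec (instr x y z) s 1 (s.setReg x (op (s.reg y) (s.reg z))))
    {f g : Input k → (ι → ℕ) → (κ → Rows k) → ℕ} (hf : PolyNum f) (hg : PolyNum g) :
    PolyNum fun I y X => op (f I y X) (g I y X) :=
  hf.letNum (g := fun I y X a => op a (g I y X)) <|
    (hg.reindex some id).letNum (g := fun _ y _ b => op (y none) b) <|
      of_exec fun ℓ => ⟨_, fun s => hop ℓ.reg (ℓ.num (some none)) (ℓ.num none) s⟩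

theorem add {f g : Input k → (ι → ℕ) → (κ → Rows k) → ℕ} (hf : PolyNum f) (hg : PolyNum g) :
    PolyNum fun I y X => f I y X + g I y X :=
  of_instr (· + ·) .add (fun x y z s => .add s x y z) hf hg

theorem sub {f g : Input k → (ι → ℕ) → (κ → Rows k) → ℕ} (hf : PolyNum f) (hg : PolyNum g) :
    PolyNum fun I y X => f I y X - g I y X :=
  of_instr (· - ·) .sub (fun x y z s => .sub s x y z) hf hg

theorem mul_const {f : Input k → (ι → ℕ) → (κ → Rows k) → ℕ} (hf : PolyNum f) (c : ℕ) :
    PolyNum fun I y X => f I y X * c := by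
  induction c with
  | zero => exact const 0
  | succ c ih => exact ih.add hf

theorem data (i : Fin k) {f : Input k → (ι → ℕ) → (κ → Rows k) → ℕ} (hf : PolyNum f) :
    PolyNum fun I y X => I.data i (f I y X) :=
  hf.letNum (g := fun I _ _ a => I.data i a) <|
    of_exec fun ℓ => ⟨_, fun s => .load s _ i (ℓ.num none)⟩

theorem ite_ne_zero {c f g : Input k → (ι → ℕ) → (κ → Rows k) → ℕ} (hc : PolyNum c)
    (hf : PolyNum f) (hg : PolyNum g) :
    PolyNum fun I y X => if c I y X ≠ 0 then f I y X else g I y X := by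
  intro ℓ
  obtain ⟨P, p, hP⟩ := hc ℓ
  obtain ⟨P₁, p₁, hP₁⟩ := hf ℓ
  obtain ⟨P₂, p₂, hP₂⟩ := hg ℓ
  refine ⟨.seq P (.ifNZ ℓ.reg P₁ P₂), p + (p₁ + p₂ + 1), fun s => ((hP s).seq
    fun t ⟨ht, hv⟩ => Runs.ifNZ
      (fun h => (hP₁ t).mono (by rw [ht.size]) fun t' ⟨ht', hv'⟩ => ⟨ht.trans ht', ?_⟩)
      fun h => (hP₂ t).mono (by rw [ht.size]) fun t' ⟨ht', hv'⟩ => ⟨ht.trans ht', ?_⟩).mono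
    (by simp) fun _ => id⟩
  · rw [hv'.trans (ht.eval f)]
    exact (if_pos fun h' => h (hv.trans h')).symm
  · rw [hv'.trans (ht.eval g)]
    exact (if_neg (not_not.2 (hv.symm.trans h))).symm

theorem ite {c : Input k → (ι → ℕ) → (κ → Rows k) → Prop} [∀ I y X, Decidable (c I y X)]
    {f g : Input k → (ι → ℕ) → (κ → Rows k) → ℕ} (hc : PolyPred c) (hf : PolyNum f)
    (hg : PolyNum g) : PolyNum fun I y X => if c I y X then f I y X else g I y X := by
  convert ite_ne_zero hc hf hg using 5
  simp

theorem sum {f : Input k → (ι → ℕ) → (κ → Rows k) → ℕ → ℕ}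
    (hf : PolyNum fun I (y : Option ι → ℕ) X => f I (fun i => y (some i)) X (y none)) :
    PolyNum fun I y X => ∑ j ∈ Finset.range I.size, f I y X j := by
  intro ℓ
  obtain ⟨P, p, hP⟩ := hf (ℓ.bindNum 2 4 (by simp))
  refine ⟨.seq (.const ℓ.reg 0) (.seq (.move (ℓ.reg + 1) k) (countLoop (ℓ.reg + 1)
    (.seq P (.add ℓ.reg ℓ.reg (ℓ.reg + 4))))), .X * (p + 4) + 5, fun s => ?_⟩
  let φ (j : ℕ) (t : State) : Prop := ℓ.Keeps s t ∧
    t.reg ℓ.reg = ∑ i ∈ Finset.range j, ℓ.eval (fun I y X => f I y X i) s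
  have hround (j : ℕ) (t : State) (htj : t.reg (ℓ.reg + 1 + 1) = j) (ht : φ j t) :
      Runs (.seq P (.add ℓ.reg ℓ.reg (ℓ.reg + 4))) t (p.eval (s.reg k) + 1) fun t' =>
        φ (j + 1) t' ∧ Set.EqOn t'.reg t.reg (Set.Ico (ℓ.reg + 1) (ℓ.reg + 1 + 3)) := by
    refine ((hP t).mono (by rw [ht.1.size]) fun _ => id).seq fun t' ⟨ht', hv⟩ =>
      (Exec.add t' _ _ _).runs ⟨⟨?_, ?_⟩, fun z hz => ?_⟩
    · exact (ht.1.trans ht'.of_raise).trans (Layout.keeps_setReg le_rfl _)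
    · have hacc : t'.reg ℓ.reg = t.reg ℓ.reg := ht'.reg (Nat.lt_add_of_pos_right four_pos)
      have hterm : t'.reg (ℓ.reg + 4) = ℓ.eval (fun I y X => f I y X j) s := by
        rw [← ht.1.eval, ← htj]; exact hv
      rw [Finset.sum_range_succ, ← ht.2, ← hterm, ← hacc]
      simp [State.setReg_reg]
    · rw [State.setReg_reg, if_neg (by rintro rfl; exact absurd hz.1 (Nat.not_succ_le_self _))]
      exact ht'.reg hz.2
  refine ((Exec.const s _ _).runs rfl |>.seq fun t ht => (Exec.move t _ _).runs rfl |>.seq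
    fun t' ht' => Runs.countLoop (φ := φ) ?_ (fun j t _ => hround j t) (n := s.reg k) ?_ ?_).mono
    (by
      simp only [add_assoc, Nat.reduceAdd, Polynomial.eval_add, Polynomial.eval_mul,
        Polynomial.eval_X, Polynomial.eval_ofNat]
      omega) fun _ => id
  · exact fun h ht => ⟨ht.1.trans (h.mono (Set.Iio_subset_Iio (by simp)) (Set.subset_univ _)),
      (h.reg (by simp)).trans ht.2⟩
  · subst ht ht'
    simp [State.setReg_reg, ℓ.lt_reg.ne]
  · subst ht ht'
    exact ⟨(Layout.keeps_setReg le_rfl _).trans (Layout.keeps_setReg (by simp) _),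
      by simp [State.setReg_reg]⟩

theorem congr {f g : Input k → (ι → ℕ) → (κ → Rows k) → ℕ} (hf : PolyNum f)
    (h : ∀ I y X, (∀ c, X c ⊆ I.rows) → g I y X = f I y X) : PolyNum g := by
  intro ℓ
  obtain ⟨P, p, hP⟩ := hf ℓ
  exact ⟨P, p, fun s => (hP s).mono le_rfl fun s' hs' =>
    ⟨hs'.1, hs'.2.trans (h _ _ _ fun c => s.marked_subset _).symm⟩⟩

theorem sum_finset {γ : Type*} (F : Finset γ) {f : γ → Input k → (ι → ℕ) → (κ → Rows k) → ℕ}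
    (hf : ∀ c ∈ F, PolyNum (f c)) : PolyNum fun I y X => ∑ c ∈ F, f c I y X := by
  classical
  induction F using Finset.induction_on with
  | empty => exact const 0
  | insert c F hc ih =>
    simp only [Finset.sum_insert hc]
    exact (hf c (Finset.mem_insert_self c F)).add
      (ih fun c' h => hf c' (Finset.mem_insert_of_mem h))

theorem sum_pi {n : ℕ} {f : Input k → (ι → ℕ) → (κ → Rows k) → (Fin n → ℕ) → ℕ}
    (hf : PolyNum fun I (y : ι ⊕ Fin n → ℕ) X =>
      f I (fun i => y (.inl i)) X fun c => y (.inr c)) :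
    PolyNum fun I y X =>
      ∑ J ∈ Fintype.piFinset fun _ : Fin n => Finset.range I.size, f I y X J := by
  induction n generalizing ι with
  | zero =>
    convert hf.reindex (Sum.elim id Fin.elim0) id using 5 with I y X
    rw [Fintype.piFinset_of_isEmpty, Finset.univ_unique, Finset.sum_singleton]
    exact congrArg (f I y X) (Subsingleton.elim _ _)
  | succ n ih =>
    have hcons : PolyNum fun I y X => ∑ j ∈ Finset.range I.size,
        ∑ J ∈ Fintype.piFinset fun _ : Fin n => Finset.range I.size, f I y X (Fin.cons j J) := by
      refine sum (ih ?_)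
      convert hf.reindex (ι' := Option ι ⊕ Fin n)
        (Sum.elim (fun i => .inl (some i)) (Fin.cons (.inl none) .inr)) id using 4 with I y X
      refine congrArg (f I (fun i => y (.inl (some i))) X) (funext fun c => ?_)
      cases c using Fin.cases <;> simp
    refine hcons.congr fun I y X _ => ?_
    rw [← Finset.sum_product']
    exact Finset.sum_equiv (Fin.consEquiv fun _ => ℕ).symm (by simp [Fin.forall_fin_succ, Fin.tail])
      fun J _ => by simp [Fin.consEquiv]

theorem size_pow (n : ℕ) :
    PolyNum fun (I : Input k) (_ : ι → ℕ) (_ : κ → Rows k) => I.size ^ n := by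
  refine (sum_pi (n := n) (f := fun _ _ _ _ => 1) (const 1)).congr fun I _ _ _ => ?_
  simp

end PolyNum

namespace PolyPred

variable {p q : Input k → (ι → ℕ) → (κ → Rows k) → Prop}
  {f g : Input k → (ι → ℕ) → (κ → Rows k) → ℕ}

open Classical in
theorem congr (hp : PolyPred p) (h : ∀ I y X, (∀ c, X c ⊆ I.rows) → (q I y X ↔ p I y X)) :
    PolyPred q :=
  PolyNum.congr hp fun I y X hX => if_congr (h I y X hX) rfl rfl

theorem const (p : Prop) : PolyPred fun (_ : Input k) (_ : ι → ℕ) (_ : κ → Rows k) => p :=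
  PolyNum.const _

theorem reindex (hp : PolyPred p) (ρ : ι → ι') (τ : κ → κ') :
    PolyPred fun I y X => p I (fun i => y (ρ i)) fun c => X (τ c) :=
  PolyNum.reindex hp ρ τ

theorem not (hp : PolyPred p) : PolyPred fun I y X => ¬p I y X :=
  ((PolyNum.const 1).sub hp).congr fun I y X _ => by by_cases h : p I y X <;> simp [h]

theorem and (hp : PolyPred p) (hq : PolyPred q) : PolyPred fun I y X => p I y X ∧ q I y X := by
  classical
  exact (PolyNum.ite hp hq (.const 0)).congr fun I y X _ => by
    by_cases h : p I y X <;> simp [h]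

theorem or (hp : PolyPred p) (hq : PolyPred q) : PolyPred fun I y X => p I y X ∨ q I y X :=
  (hp.not.and hq.not).not.congr fun I y X _ => by tauto

theorem le (hf : PolyNum f) (hg : PolyNum g) : PolyPred fun I y X => f I y X ≤ g I y X :=
  ((PolyNum.const 1).sub (hf.sub hg)).congr fun I y X _ => by split_ifs <;> omega

theorem lt (hf : PolyNum f) (hg : PolyNum g) : PolyPred fun I y X => f I y X < g I y X :=
  le (hf.add (.const 1)) hg

theorem eq (hf : PolyNum f) (hg : PolyNum g) : PolyPred fun I y X => f I y X = g I y X :=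
  ((le hf hg).and (le hg hf)).congr fun _ _ _ _ => le_antisymm_iff

theorem forall_finite {γ : Type*} [Finite γ] {p : γ → Input k → (ι → ℕ) → (κ → Rows k) → Prop}
    (hp : ∀ c, PolyPred (p c)) : PolyPred fun I y X => ∀ c, p c I y X :=
  have := Fintype.ofFinite γ
  (eq (PolyNum.sum_finset Finset.univ fun c _ => (hp c).not) (.const 0)).congr
    fun I y X _ => by simp

theorem exists_pi {n : ℕ} {p : Input k → (ι → ℕ) → (κ → Rows k) → (Fin n → ℕ) → Prop}
    (hp : PolyPred fun I (y : ι ⊕ Fin n → ℕ) X =>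
      p I (fun i => y (.inl i)) X fun c => y (.inr c)) :
    PolyPred fun I y X =>
      ∃ J ∈ Fintype.piFinset fun _ : Fin n => Finset.range I.size, p I y X J := by
  classical
  refine (eq (PolyNum.sum_pi (f := fun I y X J => if p I y X J then 1 else 0) hp)
    (.const 0)).not.congr fun I y X _ => ?_
  simp

theorem mem (c : κ) (i : Fin k) (hf : PolyNum f) : PolyPred fun I y X => (i, f I y X) ∈ X c := by
  intro ℓ
  obtain ⟨P, p, hP⟩ := ((hf.mul_const k).add (.const i)) ℓ
  obtain ⟨P', p', hP'⟩ := lt hf PolyNum.size ℓ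
  refine ⟨.seq P (.seq (.load ℓ.reg (ℓ.set c) ℓ.reg) (.ifNZ ℓ.reg P' (.const ℓ.reg 0))),
    p + (1 + (p' + 1 + 1)), fun s => ((hP s).seq fun t ⟨ht, hv⟩ =>
      (Exec.load t _ _ _).runs rfl |>.seq (b' := p'.eval (s.reg k) + 1 + 1) fun t' ht' => ?_).mono
    (by simp) fun _ => id⟩
  have hst : ℓ.Keeps s t' := ht' ▸ ht.trans (Layout.keeps_setReg le_rfl _)
  have hcell : t'.reg ℓ.reg = s.mem (ℓ.set c) (ℓ.eval f s * k + i) := by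
    rw [← ht', State.setReg_reg, if_pos rfl, hv, ht.mem (ℓ.set_mem c)]
    rfl
  refine Runs.ifNZ (fun h => (hP' t').mono (by rw [hst.size]) fun u ⟨hu, hvu⟩ =>
    ⟨hst.trans hu, ?_⟩) fun h => (Exec.const t' _ 0).runs
      ⟨hst.trans (Layout.keeps_setReg le_rfl _), ?_⟩
  · rw [hcell] at h
    rw [hvu, hst.eval]
    by_cases hlt : ℓ.eval f s < s.reg k
    · exact (if_pos hlt).trans (if_pos (State.mem_marked.2 ⟨hlt, h⟩)).symm
    · exact (if_neg hlt).trans (if_neg fun hmem => hlt (State.mem_marked.1 hmem).1).symm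
  · rw [hcell] at h
    rw [State.setReg_reg, if_pos rfl]
    exact (if_neg fun hmem => (State.mem_marked.1 hmem).2 h).symm

end PolyPred

end PolyNum

section PolySet

variable {k : ℕ} {ι κ : Type}

/-- The set of rows `F` is computable in a number of steps that is polynomial in the loop limit. -/
def PolySet (F : Input k → (ι → ℕ) → (κ → Rows k) → Rows k) : Prop :=
  ∀ (ℓ : Layout k ι κ) (a : ℕ), a ∉ ℓ.arrays → ∃ (P : Prog) (p : Polynomial ℕ), ∀ s,
    Runs P s (p.eval (s.reg k)) fun s' => ℓ.Keeps s s' ∧ s'.marked k a = ℓ.eval F s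

theorem PolyNum.runs_store {f g : Input k → (ι → ℕ) → (κ → Rows k) → ℕ} (hf : PolyNum f)
    (hg : PolyNum g) (ℓ : Layout k ι κ) {a : ℕ} (ha : a ∈ ℓ.arrays) :
    ∃ (P : Prog) (p : Polynomial ℕ), ∀ s, Runs P s (p.eval (s.reg k)) fun s' =>
      Agree (Set.Iio ℓ.reg) (ℓ.arrays \ {a} : Set ℕ) s s' ∧
        s'.mem a = Function.update (s.mem a) (ℓ.eval f s) (ℓ.eval g s) := by
  obtain ⟨P, p, hP⟩ := hf ℓ
  obtain ⟨P', p', hP'⟩ := hg (ℓ.raise 1)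
  refine ⟨.seq P (.seq P' (.store a ℓ.reg (ℓ.reg + 1))), p + (p' + 1), fun s =>
    ((hP s).seq fun t ⟨ht, hv⟩ => ((hP' t).mono (by rw [ht.size]) fun _ => id).seq
      fun t' ⟨ht', hv'⟩ => (Exec.store t' a ℓ.reg (ℓ.reg + 1)).runs ⟨?_, ?_⟩).mono
    (by simp) fun _ => id⟩
  · exact ((ht.trans ht'.of_raise).mono subset_rfl Set.sdiff_subset).trans
      (agree_setMem (by simp) _ _)
  · have hpos : t'.reg ℓ.reg = ℓ.eval f s := (ht'.reg (Nat.lt_succ_self _)).trans hv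
    have hval : t'.reg (ℓ.reg + 1) = ℓ.eval g s := hv'.trans (ht.eval g)
    rw [← ht.mem ha, ← ht'.mem ha, ← hpos, ← hval]
    exact Function.update_self ..

namespace PolySet

theorem congr {F G : Input k → (ι → ℕ) → (κ → Rows k) → Rows k} (hF : PolySet F)
    (h : ∀ I y X, (∀ c, X c ⊆ I.rows) → G I y X = F I y X) : PolySet G := by
  intro ℓ a ha
  obtain ⟨P, p, hP⟩ := hF ℓ a ha
  exact ⟨P, p, fun s => (hP s).mono le_rfl fun s' hs' =>
    ⟨hs'.1, hs'.2.trans (h _ _ _ fun c => s.marked_subset _).symm⟩⟩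

theorem letSet {F : Input k → (ι → ℕ) → (κ → Rows k) → Rows k} (hF : PolySet F)
    {G : Input k → (ι → ℕ) → (κ → Rows k) → Rows k → Rows k}
    (hG : PolySet fun I y (X : Option κ → Rows k) => G I y (fun c => X (some c)) (X none)) :
    PolySet fun I y X => G I y X (F I y X) := by
  intro ℓ a ha
  obtain ⟨b, hb⟩ := Infinite.exists_notMem_finset (insert a ℓ.arrays)
  rw [Finset.mem_insert, not_or] at hb
  obtain ⟨P, p, hP⟩ := hF ℓ b hb.2
  obtain ⟨P', p', hP'⟩ := hG (ℓ.bindSet b (Layout.le_of_notMem_arrays hb.2)) a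
    (by simpa [Layout.bindSet] using ⟨Ne.symm hb.1, ha⟩)
  refine ⟨.seq P P', p + p', fun s => ((hP s).seq fun t ⟨ht, hv⟩ =>
    (hP' t).mono (by rw [ht.size]) fun t' ⟨ht', hv'⟩ => ⟨ht.trans ht'.of_bindSet, ?_⟩).mono
    (by simp) fun _ => id⟩
  calc _ = ℓ.eval (fun I y X => G I y X (t.marked k b)) t := hv'
    _ = ℓ.eval (fun I y X => G I y X (ℓ.eval F s)) s := by rw [hv, ht.eval]

section Sep

variable {p : Input k → (ι → ℕ) → (κ → Rows k) → Fin k × ℕ → Prop}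

open Classical in
theorem runs_markTable (i : Fin k) (hp : PolyPred fun I (y : Option ι → ℕ) X =>
      p I (fun i => y (some i)) X (i, y none)) (ℓ : Layout k ι κ) {a : ℕ} (ha : a ∉ ℓ.arrays) :
    ∃ (P : Prog) (q : Polynomial ℕ), ∀ s, Runs P s (q.eval (s.reg k)) fun s' => ℓ.Keeps s s' ∧
      s'.marked k a = (s.input k).rows.filter fun v =>
        if v.1 = i then ℓ.eval p s v else v ∈ s.marked k a := by
  obtain ⟨P, q, hP⟩ := (((PolyNum.num none).mul_const k).add (.const i)).runs_store
    (hp.reindex id some) ((ℓ.bindNum 1 3 (by simp)).bindSet a (ℓ.le_of_notMem_arrays ha))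
    (Finset.mem_insert_self _ _)
  refine ⟨.seq (.move ℓ.reg k) (countLoop ℓ.reg P), .X * (q + 3) + 4, fun s => ?_⟩
  let φ (j : ℕ) (t : State) : Prop := ℓ.Keeps s t ∧ ∀ v, t.mem a (cell v) =
    if v.1 = i ∧ v.2 < j then if ℓ.eval p s v then 1 else 0 else s.mem a (cell v)
  have hround (j : ℕ) (t : State) (htj : t.reg (ℓ.reg + 1) = j) (ht : φ j t) :
      Runs P t (q.eval (s.reg k)) fun t' =>
        φ (j + 1) t' ∧ Set.EqOn t'.reg t.reg (Set.Ico ℓ.reg (ℓ.reg + 3)) := by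
    refine (hP t).mono (by rw [ht.1.size]) fun t' ⟨ht', hm⟩ => ⟨⟨ht.1.trans ?_, fun v => ?_⟩, ?_⟩
    · exact ht'.mono (Set.Iio_subset_Iio (Nat.le_add_right _ _)) fun c hc =>
        ⟨Finset.mem_insert_of_mem hc, fun h => ha (h ▸ hc)⟩
    · have hupdate : t'.mem a = Function.update (t.mem a) (cell (i, j))
          (if ℓ.eval p s (i, j) then 1 else 0) := by
        rw [hm, ← htj, ← ht.1.eval]
        rfl
      rw [hupdate]
      exact update_cell_eq_ite (f := fun v => if ℓ.eval p s v then 1 else 0) ht.2 v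
    · exact ht'.reg.mono fun z hz => hz.2
  refine ((Exec.move s _ _).runs rfl |>.seq fun t ht => Runs.countLoop (φ := φ) (n := s.reg k)
    (fun h ht => ⟨ht.1.trans (h.mono subset_rfl (Set.subset_univ _)), fun v => ?_⟩)
    (fun j t _ => hround j t) ?_ ?_).mono
    (by
      simp only [Polynomial.eval_add, Polynomial.eval_mul, Polynomial.eval_X, Polynomial.eval_ofNat]
      omega) fun t ⟨ht, hm⟩ => ⟨ht, ?_⟩
  · rw [h.mem (Set.mem_univ a), ht.2]
  · subst ht
    simp [State.setReg_reg]
  · subst ht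
    exact ⟨Layout.keeps_setReg le_rfl _, fun v => by simp [State.setReg]⟩
  · ext v
    rw [State.mem_marked, Finset.mem_filter, Input.mem_rows, ht.size, hm]
    refine and_congr_right fun hv => ?_
    by_cases hi : v.1 = i
    · simp [hi, hv]
    · simp [hi, State.mem_marked, hv]

theorem filter [∀ I y X, DecidablePred (p I y X)]
    (hp : ∀ i, PolyPred fun I (y : Option ι → ℕ) X => p I (fun i => y (some i)) X (i, y none)) :
    PolySet fun I y X => I.rows.filter (p I y X) := by
  classical
  intro ℓ a ha
  have hlist (l : List (Fin k)) : ∃ (P : Prog) (q : Polynomial ℕ), ∀ s,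
      Runs P s (q.eval (s.reg k)) fun s' => ℓ.Keeps s s' ∧ s'.marked k a =
        (s.input k).rows.filter fun v => if v.1 ∈ l then ℓ.eval p s v else v ∈ s.marked k a := by
    induction l with
    | nil =>
      refine ⟨.skip, 1, fun s => ((Exec.skip s).runs ⟨.refl _ _ s, ?_⟩).mono (by simp) fun _ => id⟩
      simp [Finset.filter_mem_eq_inter, Finset.inter_eq_right.2 (s.marked_subset a)]
    | cons i l ih =>
      obtain ⟨P, q, hP⟩ := runs_markTable i (hp i) ℓ ha
      obtain ⟨P', q', hP'⟩ := ih
      refine ⟨.seq P P', q + q', fun s => ((hP s).seq fun t ⟨ht, hv⟩ =>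
        (hP' t).mono (by rw [ht.size]) fun t' ⟨ht', hv'⟩ => ⟨ht.trans ht', ?_⟩).mono
        (by simp) fun _ => id⟩
      rw [hv', ht.input, ht.eval, hv]
      refine Finset.filter_congr fun v hv => ?_
      by_cases hl : v.1 ∈ l <;> by_cases hi : v.1 = i <;> simp [hl, hi, hv]
  obtain ⟨P, q, hP⟩ := hlist (List.finRange k)
  refine ⟨P, q, fun s => (hP s).mono le_rfl fun s' ⟨hs', hv⟩ => ⟨hs', hv.trans ?_⟩⟩
  exact Finset.filter_congr fun v _ => by rw [if_pos (List.mem_finRange v.1)]; rfl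

theorem set (c : κ) : PolySet fun (_ : Input k) (_ : ι → ℕ) X => X c := by
  classical
  refine (filter (p := fun _ _ X v => v ∈ X c) fun i => PolyPred.mem c i (.num none)).congr
    fun I _ X hX => ?_
  exact (Finset.filter_mem_eq_inter.trans (Finset.inter_eq_right.2 (hX c))).symm

end Sep

theorem runs_update {F : Input k → (ι → ℕ) → (Option κ → Rows k) → Rows k} (hF : PolySet F)
    (ℓ : Layout k ι κ) {a : ℕ} (ha : a ∉ ℓ.arrays) :
    ∃ (P : Prog) (p : Polynomial ℕ), ∀ s, Runs P s (p.eval (s.reg k)) fun s' => ℓ.Keeps s s' ∧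
      s'.marked k a = (ℓ.bindSet a (ℓ.le_of_notMem_arrays ha)).eval F s := by
  obtain ⟨b, hb⟩ := Infinite.exists_notMem_finset (insert a ℓ.arrays)
  obtain ⟨P, p, hP⟩ := hF (ℓ.bindSet a (ℓ.le_of_notMem_arrays ha)) b hb
  rw [Finset.mem_insert, not_or] at hb
  obtain ⟨P', p', hP'⟩ := set none (ℓ.bindSet b (ℓ.le_of_notMem_arrays hb.2)) a
    (by simpa [Layout.bindSet] using ⟨Ne.symm hb.1, ha⟩)
  exact ⟨.seq P P', p + p', fun s => ((hP s).seq fun t ⟨ht, hv⟩ =>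
    (hP' t).mono (by rw [ht.size]) fun t' ⟨ht', hv'⟩ =>
      ⟨ht.of_bindSet.trans ht'.of_bindSet, hv'.trans hv⟩).mono (by simp) fun _ => id⟩

theorem foldl_range {n : Input k → (ι → ℕ) → (κ → Rows k) → ℕ} (hn : PolyNum n)
    {q : Polynomial ℕ} (hq : ∀ I y X, n I y X ≤ q.eval I.size)
    {F₀ : Input k → (ι → ℕ) → (κ → Rows k) → Rows k} (hF₀ : PolySet F₀)
    {F : Input k → (ι → ℕ) → (κ → Rows k) → ℕ → Rows k → Rows k}
    (hF : PolySet fun I (y : Option ι → ℕ) (X : Option κ → Rows k) =>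
      F I (fun i => y (some i)) (fun c => X (some c)) (y none) (X none)) :
    PolySet fun I y X => (List.range (n I y X)).foldl (fun S j => F I y X j S) (F₀ I y X) := by
  intro ℓ a ha
  have hka := ℓ.le_of_notMem_arrays ha
  obtain ⟨P₀, p₀, hP₀⟩ := hF₀ ℓ a ha
  obtain ⟨Pₙ, pₙ, hPₙ⟩ := (hn.reindex id some) (ℓ.bindSet a hka)
  obtain ⟨P, p, hP⟩ := hF.runs_update (ℓ.bindNum 1 3 (by simp)) ha
  refine ⟨.seq P₀ (.seq Pₙ (countLoop ℓ.reg P)), p₀ + (pₙ + (q * (p + 3) + 3)), fun s => ?_⟩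
  let φ (j : ℕ) (t : State) : Prop := ℓ.Keeps s t ∧ t.marked k a =
    (List.range j).foldl (fun S j => ℓ.eval (fun I y X => F I y X j S) s) (ℓ.eval F₀ s)
  have hround (j : ℕ) (t : State) (htj : t.reg (ℓ.reg + 1) = j) (ht : φ j t) :
      Runs P t (p.eval (s.reg k)) fun t' =>
        φ (j + 1) t' ∧ Set.EqOn t'.reg t.reg (Set.Ico ℓ.reg (ℓ.reg + 3)) := by
    refine (hP t).mono (by rw [ht.1.size]) fun t' ⟨ht', hv⟩ =>
      ⟨⟨ht.1.trans ht'.of_raise, ?_⟩, ht'.reg.mono fun z hz => hz.2⟩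
    calc t'.marked k a
        = ℓ.eval (fun I y X => F I y X (t.reg (ℓ.reg + 1)) (t.marked k a)) t := hv
      _ = _ := by rw [ht.1.eval, htj, ht.2, List.range_succ, List.foldl_append]; rfl
  refine ((hP₀ s).seq fun t ⟨ht, hv⟩ => ((hPₙ t).mono (by rw [ht.size]) fun _ => id).seq
    fun t' ⟨ht', hn'⟩ => (Runs.countLoop (φ := φ) (n := ℓ.eval n s)
      (fun h ht => ⟨ht.1.trans (h.mono subset_rfl (Set.subset_univ _)), ?_⟩)
      (fun j t _ => hround j t) ?_ ⟨ht.trans ht'.of_bindSet, ?_⟩).mono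
        (b' := q.eval (s.reg k) * (p.eval (s.reg k) + 3) + 3) ?_ fun u hu => hu).mono
    (by simp) fun _ => id
  · exact (Agree.marked h ℓ.lt_reg (Set.mem_univ a)).trans ht.2
  · exact hn'.trans (ht.eval n)
  · exact (Agree.marked ht' ℓ.lt_reg (Finset.mem_insert_self _ _)).trans hv
  · exact Nat.add_le_add_right (Nat.mul_le_mul_right _ (hq _ _ _)) _

end PolySet

end PolySet

section PolyCmd

variable {k : ℕ} {ι κ : Type} {α : Type*}

/-- The registers and arrays in use have the same contents in `s'` as in `s`, except for those that
hold the tables. -/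
def Layout.KeepsVars (ℓ : Layout k ι κ) : State → State → Prop :=
  Agree (Set.Ico k ℓ.reg) {a ∈ (ℓ.arrays : Set ℕ) | k ≤ a}

/-- Replacing the tables by those of `g` is possible in a number of steps that is polynomial in the
loop limit, which `g` must not change. -/
def PolyCmd (g : Input k → (ι → ℕ) → (κ → Rows k) → Input k) : Prop :=
  ∀ ℓ : Layout k ι κ, ∃ (P : Prog) (p : Polynomial ℕ), ∀ s, Runs P s (p.eval (s.reg k))
    fun s' => ℓ.KeepsVars s s' ∧ s'.input k = ℓ.eval g s

/-- The tables with `v` as value `p` of table `i`. -/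
def Input.setData (I : Input k) (i : Fin k) (p v : ℕ) : Input k :=
  { I with data := Function.update I.data i (Function.update (I.data i) p v) }

/-- The tables with `n` as number of rows of table `i`. -/
def Input.setLen (I : Input k) (i : Fin k) (n : ℕ) : Input k :=
  { I with len := Function.update I.len i n }

namespace Layout

variable {ℓ : Layout k ι κ} {s s' : State}

theorem Keeps.keepsVars (h : ℓ.Keeps s s') : ℓ.KeepsVars s s' :=
  h.mono (fun _ hx => hx.2) fun _ ha => ha.1

theorem KeepsVars.size (h : ℓ.KeepsVars s s') : s'.reg k = s.reg k := h.reg ⟨le_rfl, ℓ.lt_reg⟩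

theorem KeepsVars.eval (h : ℓ.KeepsVars s s') (f : Input k → (ι → ℕ) → (κ → Rows k) → α) :
    ℓ.eval f s' = ℓ.eval (fun _ => f (s'.input k)) s := by
  have hnum (i : ι) : s'.reg (ℓ.num i) = s.reg (ℓ.num i) :=
    h.reg ⟨(ℓ.lt_num i).le, ℓ.num_lt i⟩
  have hset (c : κ) : s'.marked k (ℓ.set c) = s.marked k (ℓ.set c) :=
    Agree.marked h ⟨le_rfl, ℓ.lt_reg⟩ ⟨ℓ.set_mem c, ℓ.le_set c⟩
  simp only [Layout.eval, hnum, hset]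

end Layout

namespace PolyCmd

theorem id : PolyCmd fun (I : Input k) (_ : ι → ℕ) (_ : κ → Rows k) => I := fun ℓ =>
  ⟨.skip, 1, fun s => ((Exec.skip s).runs ⟨.refl _ _ s, rfl⟩).mono (by simp) fun _ => _root_.id⟩

theorem setData (i : Fin k) {f g : Input k → (ι → ℕ) → (κ → Rows k) → ℕ} (hf : PolyNum f)
    (hg : PolyNum g) : PolyCmd fun I y X => I.setData i (f I y X) (g I y X) := by
  intro ℓ
  obtain ⟨P, p, hP⟩ := hf.runs_store hg ℓ (ℓ.mem_arrays i i.2)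
  refine ⟨P, p, fun s => (hP s).mono le_rfl fun s' ⟨hs', hv⟩ => ⟨hs'.mono (fun _ hx => hx.2)
    fun a ha => ⟨ha.1, fun h => (h ▸ ha.2).not_gt i.2⟩, ?_⟩⟩
  refine Input.ext (hs'.reg ℓ.lt_reg) (funext fun i' => hs'.reg (i'.2.trans ℓ.lt_reg))
    (funext fun i' => ?_)
  change s'.mem i' = Function.update (s.input k).data i _ i'
  obtain rfl | h := eq_or_ne i' i
  · rw [Function.update_self, hv]
    rfl
  · rw [Function.update_of_ne h, hs'.mem ⟨ℓ.mem_arrays i' i'.2, fun h' => h (Fin.ext h')⟩]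
    rfl

theorem setLen (i : Fin k) {f : Input k → (ι → ℕ) → (κ → Rows k) → ℕ} (hf : PolyNum f) :
    PolyCmd fun I y X => I.setLen i (f I y X) := by
  intro ℓ
  obtain ⟨P, p, hP⟩ := hf ℓ
  refine ⟨.seq P (.move i ℓ.reg), p + 1, fun s => ((hP s).seq fun t ⟨ht, hv⟩ =>
    (Exec.move t i ℓ.reg).runs ⟨ht.keepsVars.trans (agree_setReg (fun h => h.1.not_gt i.2) _),
      ?_⟩).mono (by simp) fun _ => _root_.id⟩
  rw [hv]
  refine Input.ext ?_ (funext fun i' => ?_) (funext fun i' => ht.mem (ℓ.mem_arrays i' i'.2))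
  · exact (Function.update_of_ne i.2.ne' _ _).trans ht.size
  · change Function.update t.reg i _ i' = Function.update (s.input k).len i _ i'
    obtain rfl | h := eq_or_ne i' i
    · rw [Function.update_self, Function.update_self]
      rfl
    · rw [Function.update_of_ne h, Function.update_of_ne fun h' => h (Fin.ext h')]
      exact ht.reg (i'.2.trans ℓ.lt_reg)

variable {g : Input k → (ι → ℕ) → (κ → Rows k) → Input k}

theorem comp {g' : Input k → (ι → ℕ) → (κ → Rows k) → Input k} (hg' : PolyCmd g')
    (hg : PolyCmd g) : PolyCmd fun I y X => g' (g I y X) y X := by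
  intro ℓ
  obtain ⟨P, p, hP⟩ := hg ℓ
  obtain ⟨P', p', hP'⟩ := hg' ℓ
  refine ⟨.seq P P', p + p', fun s => ((hP s).seq fun t ⟨ht, hv⟩ =>
    (hP' t).mono (by rw [ht.size]) fun t' ⟨ht', hv'⟩ => ⟨ht.trans ht', ?_⟩).mono
    (by simp) fun _ => _root_.id⟩
  rw [hv', ht.eval, hv]
  rfl

theorem foldl_list {γ : Type*} (l : List γ) {g : γ → Input k → (ι → ℕ) → (κ → Rows k) → Input k}
    (hg : ∀ c, PolyCmd (g c)) : PolyCmd fun I y X => l.foldl (fun I' c => g c I' y X) I := by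
  induction l with
  | nil => exact id
  | cons c l ih => exact ih.comp (hg c)

theorem foldl_range {g : Input k → (ι → ℕ) → (κ → Rows k) → ℕ → Input k}
    (hg : PolyCmd fun I (y : Option ι → ℕ) X => g I (fun i => y (some i)) X (y none)) :
    PolyCmd fun I y X => (List.range I.size).foldl (fun I' j => g I' y X j) I := by
  intro ℓ
  obtain ⟨P, p, hP⟩ := hg (ℓ.bindNum 1 3 (by simp))
  refine ⟨.seq (.move ℓ.reg k) (countLoop ℓ.reg P), .X * (p + 3) + 4, fun s => ?_⟩
  let φ (j : ℕ) (t : State) : Prop := ℓ.KeepsVars s t ∧ t.input k =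
    (List.range j).foldl (fun I' j => ℓ.eval (fun _ y X => g I' y X j) s) (s.input k)
  have hround (j : ℕ) (t : State) (htj : t.reg (ℓ.reg + 1) = j) (ht : φ j t) :
      Runs P t (p.eval (s.reg k)) fun t' =>
        φ (j + 1) t' ∧ Set.EqOn t'.reg t.reg (Set.Ico ℓ.reg (ℓ.reg + 3)) := by
    refine (hP t).mono (by rw [ht.1.size]) fun t' ⟨ht', hv⟩ =>
      ⟨⟨ht.1.trans (ht'.mono (Set.Ico_subset_Ico_right (Nat.le_add_right _ _)) subset_rfl), ?_⟩,
        ht'.reg.mono (Set.Ico_subset_Ico_left ℓ.lt_reg.le)⟩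
    calc t'.input k
        = ℓ.eval (fun I y X => g I y X (t.reg (ℓ.reg + 1))) t := hv
      _ = _ := by rw [ht.1.eval, htj, ht.2, List.range_succ, List.foldl_append]; rfl
  refine ((Exec.move s _ _).runs rfl |>.seq fun t ht => Runs.countLoop (φ := φ) (n := s.reg k)
    (fun h ht => ⟨ht.1.trans (h.mono (fun _ hx => hx.2) (Set.subset_univ _)), ?_⟩)
    (fun j t _ => hround j t) ?_ ?_).mono
    (by
      simp only [Polynomial.eval_add, Polynomial.eval_mul, Polynomial.eval_X, Polynomial.eval_ofNat]
      omega) fun _ => _root_.id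
  · have hkeep : ℓ.Keeps _ _ := h.mono subset_rfl (Set.subset_univ _)
    exact hkeep.input.trans ht.2
  · subst ht
    simp [State.setReg_reg]
  · subst ht
    have hkeep : ℓ.Keeps s (s.setReg ℓ.reg (s.reg k)) := Layout.keeps_setReg le_rfl _
    exact ⟨hkeep.keepsVars, hkeep.input⟩

theorem letSet {F : Input k → (ι → ℕ) → (κ → Rows k) → Rows k} (hF : PolySet F)
    {G : Input k → (ι → ℕ) → (κ → Rows k) → Rows k → Input k}
    (hG : PolyCmd fun I y (X : Option κ → Rows k) => G I y (fun c => X (some c)) (X none)) :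
    PolyCmd fun I y X => G I y X (F I y X) := by
  intro ℓ
  obtain ⟨a, ha⟩ := Infinite.exists_notMem_finset ℓ.arrays
  obtain ⟨P, p, hP⟩ := hF ℓ a ha
  obtain ⟨P', p', hP'⟩ := hG (ℓ.bindSet a (Layout.le_of_notMem_arrays ha))
  refine ⟨.seq P P', p + p', fun s => ((hP s).seq fun t ⟨ht, hv⟩ =>
    (hP' t).mono (by rw [ht.size]) fun t' ⟨ht', hv'⟩ => ⟨ht.keepsVars.trans (ht'.mono subset_rfl
      fun a ha => ⟨Finset.mem_insert_of_mem ha.1, ha.2⟩), ?_⟩).mono (by simp) fun _ => _root_.id⟩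
  calc _ = ℓ.eval (fun I y X => G I y X (t.marked k a)) t := hv'
    _ = ℓ.eval (fun I y X => G I y X (ℓ.eval F s)) s := by rw [hv, ht.eval]

end PolyCmd

end PolyCmd

section Compact

variable {k : ℕ} {ι κ : Type}

namespace Input

/-- The tables after `m` values of table `i` have been copied, one after the other, from the places
starting with `r` to those starting with `p`. -/
def moveBlock (I : Input k) (i : Fin k) (p r m : ℕ) : Input k :=
  (List.range m).foldl (fun I' c => I'.setData i (p + c) (I'.data i (r + c))) I

/-- The tables after the rows of table `i` with the property `p`, which have `w` values each, have
been moved to the beginning. Every row is copied to the place after the selected rows before it; a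
row that is not selected is overwritten by the next one. -/
def compactTable (I : Input k) (i : Fin k) (w : ℕ) (p : ℕ → Prop) [DecidablePred p] : Input k :=
  (List.range I.size).foldl (fun I' r => I'.moveBlock i (Nat.count p r * w) (r * w) w)
    (I.setLen i (Nat.count p I.size))

/-- The tables after `compactTable` for each of them, where `X` is the set of selected rows. -/
def compact (I : Input k) (w : Fin k → ℕ) (X : Rows k) : Input k :=
  (List.finRange k).foldl (fun I' i => I'.compactTable i (w i) fun j => (i, j) ∈ X) I

/-- Table `i` of `I'` consists of the rows of `I` with the property `p`. -/
def IsCompaction (I I' : Input k) (i : Fin k) (w : ℕ) (p : ℕ → Prop) [DecidablePred p] : Prop :=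
  I'.len i = Nat.count p I.size ∧ ∀ r < I.size, p r → ∀ c < w,
    I'.data i (Nat.count p r * w + c) = I.data i (r * w + c)

theorem moveBlock_eq (I : Input k) (i : Fin k) {p r : ℕ} (h : p ≤ r) (m : ℕ) :
    I.moveBlock i p r m = { I with data := Function.update I.data i fun q =>
      if p ≤ q ∧ q < p + m then I.data i (r + (q - p)) else I.data i q } := by
  induction m with
  | zero =>
    have hempty (q : ℕ) : ¬(p ≤ q ∧ q < p + 0) := by omega
    simp only [moveBlock, List.range_zero, List.foldl_nil, hempty, if_false,
      Function.update_eq_self]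
  | succ m ih =>
    rw [moveBlock, List.range_succ, List.foldl_append, ← moveBlock, ih]
    simp only [List.foldl_cons, List.foldl_nil, setData, Function.update_self,
      Function.update_idem]
    congr 2
    funext q
    rw [Function.update_apply, if_neg (by omega : ¬(p ≤ r + m ∧ r + m < p + m))]
    split_ifs <;> first | omega | rfl | (congr 1; omega)

variable {p : ℕ → Prop} [DecidablePred p]

theorem exists_foldl_moveBlock (I : Input k) (i : Fin k) (w n : ℕ) : ∃ f : ℕ → ℕ,
    (List.range n).foldl (fun I' r => I'.moveBlock i (Nat.count p r * w) (r * w) w) I =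
      { I with data := Function.update I.data i f } ∧
    (∀ r < n, p r → ∀ c < w, f (Nat.count p r * w + c) = I.data i (r * w + c)) ∧
    ∀ q, n * w ≤ q → f q = I.data i q := by
  induction n with
  | zero => exact ⟨I.data i, by simp, by simp, by simp⟩
  | succ n ih =>
    obtain ⟨f, hf, hrows, hrest⟩ := ih
    have hle : Nat.count p n * w ≤ n * w := Nat.mul_le_mul_right w (Nat.count_le (p := p))
    refine ⟨fun q => if Nat.count p n * w ≤ q ∧ q < Nat.count p n * w + w then
      f (n * w + (q - Nat.count p n * w)) else f q, ?_, fun r hr hpr c hc => ?_, fun q hq => ?_⟩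
    · rw [List.range_succ, List.foldl_append, hf, List.foldl_cons, List.foldl_nil,
        moveBlock_eq _ _ hle]
      simp only [Function.update_self, Function.update_idem]
    · obtain hrn | rfl := Nat.lt_succ_iff_lt_or_eq.1 hr
      · have hcount : (Nat.count p r + 1) * w ≤ Nat.count p n * w :=
          Nat.mul_le_mul_right w (Nat.count_strict_mono hpr hrn)
        rw [add_one_mul] at hcount
        exact (if_neg (by omega)).trans (hrows r hrn hpr c hc)
      · refine (if_pos ⟨by omega, by omega⟩).trans ?_
        rw [Nat.add_sub_cancel_left, hrest _ (Nat.le_add_right _ _)]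
    · rw [add_one_mul] at hq
      exact (if_neg (by omega)).trans (hrest q (by omega))

variable (I : Input k) (i : Fin k) (w : ℕ)

theorem exists_compactTable_eq : ∃ f : ℕ → ℕ, I.compactTable i w p = { I with
      len := Function.update I.len i (Nat.count p I.size), data := Function.update I.data i f } ∧
    ∀ r < I.size, p r → ∀ c < w, f (Nat.count p r * w + c) = I.data i (r * w + c) := by
  obtain ⟨f, hf, hrows, -⟩ :=
    (I.setLen i (Nat.count p I.size)).exists_foldl_moveBlock (p := p) i w I.size
  exact ⟨f, hf, hrows⟩

theorem size_compactTable : (I.compactTable i w p).size = I.size := by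
  obtain ⟨f, hf, -⟩ := I.exists_compactTable_eq (p := p) i w
  rw [hf]

theorem isCompaction_compactTable : I.IsCompaction (I.compactTable i w p) i w p := by
  obtain ⟨f, hf, hrows⟩ := I.exists_compactTable_eq (p := p) i w
  simpa only [IsCompaction, hf, Function.update_self, true_and] using hrows

theorem compactTable_of_ne {i' : Fin k} (h : i' ≠ i) :
    (I.compactTable i w p).len i' = I.len i' ∧ (I.compactTable i w p).data i' = I.data i' := by
  obtain ⟨f, hf, -⟩ := I.exists_compactTable_eq (p := p) i w
  simp only [hf, Function.update_of_ne h, and_self]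

theorem isCompaction_compact (w : Fin k → ℕ) (X : Rows k) (i : Fin k) :
    I.IsCompaction (I.compact w X) i (w i) fun j => (i, j) ∈ X := by
  suffices h : ∀ (l : List (Fin k)), l.Nodup → ∀ I : Input k,
      let I' := l.foldl (fun I' i => I'.compactTable i (w i) fun j => (i, j) ∈ X) I
      (∀ i ∈ l, I.IsCompaction I' i (w i) fun j => (i, j) ∈ X) ∧
        ∀ i ∉ l, I'.len i = I.len i ∧ I'.data i = I.data i from
    (h _ (List.nodup_finRange k) I).1 i (List.mem_finRange i)
  intro l
  induction l with
  | nil => exact fun _ _ => ⟨by simp, by simp⟩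
  | cons i₁ l ih =>
    intro hl I
    obtain ⟨hi₁, hl⟩ := List.nodup_cons.1 hl
    obtain ⟨hmem, hnot⟩ := ih hl (I.compactTable i₁ (w i₁) fun j => (i₁, j) ∈ X)
    refine ⟨fun i hi => ?_, fun i hi => ?_⟩
    · obtain rfl | hne := eq_or_ne i i₁
      · rw [IsCompaction, List.foldl_cons, (hnot i hi₁).1, (hnot i hi₁).2]
        exact I.isCompaction_compactTable i (w i)
      · have := hmem i (List.mem_of_ne_of_mem hne hi)
        rwa [IsCompaction, size_compactTable, (I.compactTable_of_ne i₁ _ hne).2] at this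
    · obtain ⟨hne, hil⟩ := List.ne_and_not_mem_of_not_mem_cons hi
      rw [List.foldl_cons, (hnot i hil).1, (hnot i hil).2]
      exact I.compactTable_of_ne i₁ _ hne

end Input

theorem PolyNum.count {f : Input k → (ι → ℕ) → (κ → Rows k) → ℕ} (hf : PolyNum f) (c : κ)
    (i : Fin k) : PolyNum fun I y X => Nat.count (fun j => (i, j) ∈ X c) (f I y X) := by
  refine (PolyNum.sum (f := fun I y X j => if j < f I y X ∧ (i, j) ∈ X c then 1 else 0)
    (.ite (.and (.lt (.num none) (hf.reindex some _root_.id)) (.mem c i (.num none)))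
      (.const 1) (.const 0))).congr fun I y X hX => ?_
  rw [Nat.count_eq_card_filter_range, Finset.sum_boole, Nat.cast_id]
  congr 1
  ext j
  simp only [Finset.mem_filter, Finset.mem_range]
  exact ⟨fun h => ⟨Input.mem_rows.1 (hX c h.2), h⟩, fun h => h.2⟩

theorem PolyCmd.moveBlock (i : Fin k) {p r : (ι → ℕ) → (κ → Rows k) → ℕ}
    (hp : PolyNum fun (_ : Input k) => p) (hr : PolyNum fun (_ : Input k) => r) (m : ℕ) :
    PolyCmd fun I y X => I.moveBlock i (p y X) (r y X) m :=
  .foldl_list _ fun c => .setData i (hp.add (.const c)) (.data i (hr.add (.const c)))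

theorem PolyCmd.compactTable (i : Fin k) (w : ℕ) (c : κ) :
    PolyCmd fun I (_ : ι → ℕ) X => I.compactTable i w fun j => (i, j) ∈ X c :=
  (PolyCmd.foldl_range (g := fun I _ X r =>
      I.moveBlock i (Nat.count (fun j => (i, j) ∈ X c) r * w) (r * w) w)
    (.moveBlock i ((PolyNum.count (.num none) c i).mul_const w) ((PolyNum.num none).mul_const w)
      w)).comp (.setLen i (.count .size c i))

theorem PolyCmd.compact (w : Fin k → ℕ) (c : κ) :
    PolyCmd fun I (_ : ι → ℕ) X => I.compact w (X c) :=
  .foldl_list _ fun i => .compactTable i (w i) c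

end Compact

section Run

variable {k : ℕ}

/-- The layout without numbers and sets of rows. -/
def Layout.empty (k : ℕ) : Layout k Empty Empty where
  num := Empty.elim
  set := Empty.elim
  reg := k + 1
  arrays := Finset.range k
  lt_num i := i.elim
  num_lt i := i.elim
  le_set c := c.elim
  set_mem c := c.elim
  lt_reg := k.lt_succ_self
  mem_arrays _ := Finset.mem_range.2

/-- The input that the memory holds, with the total number of rows as the loop limit. -/
def State.totalInput (k : ℕ) (s : State) : Input k :=
  ⟨∑ i : Fin k, s.reg i, fun i => s.reg i, fun i => s.mem i⟩

theorem exists_runs_totalInput (k : ℕ) : ∃ (P : Prog) (b : ℕ), ∀ s,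
    Runs P s b fun s' => s'.input k = s.totalInput k := by
  obtain ⟨P, p, hP⟩ := PolyNum.sum_finset (k := k) (ι := Empty) (κ := Empty) Finset.univ
    (fun i _ => PolyNum.len i) (Layout.empty k)
  refine ⟨.seq (.const k 0) (.seq P (.move k (k + 1))), _, fun s =>
    ((Exec.const s k 0).runs rfl).seq fun t ht => ((hP t).mono (b' := p.eval 0) ?_
    fun _ => _root_.id).seq fun t' ⟨ht', hsum⟩ => (Exec.move t' k (k + 1)).runs ?_⟩
  · rw [← ht, State.setReg_reg, if_pos rfl]
  have hlen (i : Fin k) : t.reg i = s.reg i := by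
    rw [← ht, State.setReg_reg, if_neg i.2.ne]
  refine Input.ext ?_ (funext fun i => ?_) (funext fun i => ?_)
  · exact (State.setReg_reg _ _ _ _).trans ((if_pos rfl).trans
      (hsum.trans (Finset.sum_congr rfl fun i _ => hlen i)))
  · exact (State.setReg_reg _ _ _ _).trans ((if_neg i.2.ne).trans
      ((ht'.reg (i.2.trans k.lt_succ_self)).trans (hlen i)))
  · exact (ht'.mem (Finset.mem_coe.2 (Finset.mem_range.2 i.2))).trans (ht ▸ rfl)

theorem PolyCmd.exists_runs {g : Input k → (Empty → ℕ) → (Empty → Rows k) → Input k}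
    (hg : PolyCmd g) : ∃ (P : Prog) (p : Polynomial ℕ), ∀ s,
    Runs P s (p.eval (∑ i : Fin k, s.reg i)) fun s' =>
      s'.input k = g (s.totalInput k) Empty.elim Empty.elim := by
  obtain ⟨P, b, hP⟩ := exists_runs_totalInput k
  obtain ⟨P', p, hP'⟩ := hg (Layout.empty k)
  refine ⟨.seq P P', .C b + p, fun s => ((hP s).seq fun t ht => (hP' t).mono
    (le_of_eq (congrArg (fun I => p.eval I.size) ht)) fun t' ⟨_, ht'⟩ => ?_).mono
    (by simp [State.totalInput]) fun _ => _root_.id⟩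
  rw [ht', Layout.eval, ht]
  congr <;> exact Subsingleton.elim _ _

end Run

end RAM

/-- A hypergraph with coloured vertices, in which the ends of each edge have the same colour, and
with an output for each edge. The outputs are to be covered by a small set of vertices: an output
is covered when all ends of some edge with this output are chosen. -/
structure ColoredHypergraph (ε V O C : Type*) where
  /-- the vertices -/
  vertices : Finset V
  /-- the edges -/
  edges : Finset ε
  /-- the vertices of an edge -/
  ends : ε → Finset V
  /-- the output of an edge -/
  output : ε → O
  /-- the colour of a vertex -/
  color : V → C
  ends_nonempty : ∀ e ∈ edges, (ends e).Nonempty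
  ends_subset : ∀ e ∈ edges, ends e ⊆ vertices
  color_eq : ∀ e ∈ edges, ∀ v ∈ ends e, ∀ w ∈ ends e, color v = color w

namespace ColoredHypergraph

variable {ε V O C : Type*} [DecidableEq V] [DecidableEq O]
  (H : ColoredHypergraph ε V O C) {S S' A A' R : Finset V} {d n b r M : ℕ} {l : List V}

/-- The edges whose output is not covered by the vertices `S`. -/
def uncovered (S : Finset V) : Finset ε :=
  H.edges.filter fun e => ∀ e' ∈ H.edges, H.output e' = H.output e → ¬H.ends e' ⊆ S

/-- An edge is determined by its colour and its output. -/
def Unambiguous : Prop :=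
  ∀ e ∈ H.edges, ∀ e' ∈ H.edges, ∀ v ∈ H.ends e, ∀ w ∈ H.ends e', H.color v = H.color w →
    H.output e = H.output e' → e = e'

/-- The vertices `S` cover all outputs. -/
def Covers (S : Finset V) : Prop :=
  ∀ e ∈ H.edges, ∃ e' ∈ H.edges, H.output e' = H.output e ∧ H.ends e' ⊆ S

/-- The number of outputs that are not covered by the vertices `S`. -/
def numUncovered (S : Finset V) : ℕ := ((H.uncovered S).image H.output).card

/-- The edges inside `A` whose output is not covered by `S`. -/
def inside (S A : Finset V) : Finset ε := (H.uncovered S).filter fun e => H.ends e ⊆ A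

/-- The number of edges inside `A` at the vertex `v` whose output is not covered by `S`. -/
def degree (S A : Finset V) (v : V) : ℕ := ((H.inside S A).filter fun e => v ∈ H.ends e).card

/-- The largest set of vertices in which all degrees, for the outputs not covered by `S`, are at
least `d`: the `d`-core. -/
def core (d : ℕ) (S : Finset V) : Finset V :=
  (H.vertices.powerset.filter fun A => ∀ v ∈ A, d ≤ H.degree S A v).biUnion id

/-- Drop the vertices of degree less than `d`. -/
def peel (d : ℕ) (S A : Finset V) : Finset V := A.filter fun v => d ≤ H.degree S A v

/-- If the seed `v` is in the `d`-core, choose all vertices of the core that have its colour. -/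
def pick [DecidableEq C] (d : ℕ) (S : Finset V) (v : V) : Finset V :=
  S ∪ (H.core d S).filter fun w => v ∈ H.core d S ∧ H.color w = H.color v

/-- Try all seeds of a list one after the other. -/
def round [DecidableEq C] (l : List V) (d : ℕ) (S : Finset V) : Finset V := l.foldl (H.pick d) S

/-- The greedy algorithm: try all seeds with each of the thresholds `M, …, 1` for the degrees. -/
def greedy [DecidableEq C] (l : List V) : ℕ → Finset V → Finset V
  | 0, S => S
  | M + 1, S => greedy l M (H.round l (M + 1) S)

section Degree

variable {H}

theorem mem_uncovered {e : ε} : e ∈ H.uncovered S ↔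
    e ∈ H.edges ∧ ∀ e' ∈ H.edges, H.output e' = H.output e → ¬H.ends e' ⊆ S :=
  Finset.mem_filter

theorem mem_inside {e : ε} : e ∈ H.inside S A ↔ e ∈ H.uncovered S ∧ H.ends e ⊆ A :=
  Finset.mem_filter

theorem uncovered_anti (h : S ⊆ S') : H.uncovered S' ⊆ H.uncovered S :=
  Finset.monotone_filter_right _ fun _ _ he e' he' ho hS => he e' he' ho (hS.trans h)

theorem numUncovered_anti (h : S ⊆ S') : H.numUncovered S' ≤ H.numUncovered S :=
  Finset.card_le_card (Finset.image_subset_image (uncovered_anti h))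

theorem inside_subset_inside (hS : S ⊆ S') (hA : A ⊆ A') : H.inside S' A ⊆ H.inside S A' :=
  fun _ he => mem_inside.2 ⟨uncovered_anti hS (mem_inside.1 he).1, (mem_inside.1 he).2.trans hA⟩

theorem degree_le_degree (hS : S ⊆ S') (hA : A ⊆ A') (v : V) :
    H.degree S' A v ≤ H.degree S A' v :=
  Finset.card_le_card (Finset.filter_subset_filter _ (inside_subset_inside hS hA))

theorem exists_inside_of_degree_pos {v : V} (h : 0 < H.degree S A v) :
    ∃ e ∈ H.inside S A, v ∈ H.ends e := by
  obtain ⟨e, he⟩ := Finset.card_pos.1 h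
  exact ⟨e, Finset.mem_filter.1 he⟩

theorem degree_le_card (v : V) : H.degree S A v ≤ H.edges.card :=
  Finset.card_le_card ((Finset.filter_subset _ _).trans
    ((Finset.filter_subset _ _).trans (Finset.filter_subset _ _)))

end Degree

section Core

variable {H}

theorem mem_core {v : V} : v ∈ H.core d S ↔
    ∃ A ⊆ H.vertices, (∀ w ∈ A, d ≤ H.degree S A w) ∧ v ∈ A := by
  simp only [core, Finset.mem_biUnion, Finset.mem_filter, Finset.mem_powerset, id, and_assoc]

theorem core_subset : H.core d S ⊆ H.vertices := fun _ hv =>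
  have ⟨_, hA, _, hvA⟩ := mem_core.1 hv
  hA hvA

theorem subset_core (hA : A ⊆ H.vertices) (h : ∀ v ∈ A, d ≤ H.degree S A v) : A ⊆ H.core d S :=
  fun _ hv => mem_core.2 ⟨A, hA, h, hv⟩

theorem le_degree_core {v : V} (hv : v ∈ H.core d S) : d ≤ H.degree S (H.core d S) v := by
  obtain ⟨A, hA, hdeg, hvA⟩ := mem_core.1 hv
  exact (hdeg v hvA).trans (degree_le_degree subset_rfl (subset_core hA hdeg) v)

theorem core_anti (h : S ⊆ S') : H.core d S' ⊆ H.core d S :=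
  subset_core core_subset fun v hv =>
    (le_degree_core hv).trans (degree_le_degree h subset_rfl v)

theorem exists_inside_core {v : V} (hd : 0 < d) (hv : v ∈ H.core d S) :
    ∃ e ∈ H.inside S (H.core d S), v ∈ H.ends e :=
  exists_inside_of_degree_pos (hd.trans_le (le_degree_core hv))

theorem core_eq_empty_of_card_lt (h : H.edges.card < d) : H.core d S = ∅ :=
  Finset.eq_empty_of_forall_notMem fun _ hv =>
    ((le_degree_core hv).trans (degree_le_card _)).not_gt h

theorem exists_degree_lt (h : H.core d S = ∅) (hA : A ⊆ H.vertices) (hne : A.Nonempty) :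
    ∃ v ∈ A, H.degree S A v < d := by
  by_contra! hdeg
  exact hne.ne_empty (Finset.subset_empty.1 (h ▸ subset_core hA hdeg))

theorem iterate_peel_subset : (H.peel d S)^[n] A ⊆ A := by
  induction n with
  | zero => exact subset_rfl
  | succ n ih =>
    rw [Function.iterate_succ_apply']
    exact (Finset.filter_subset _ _).trans ih

theorem peel_iterate_peel (hn : A.card ≤ n) :
    H.peel d S ((H.peel d S)^[n] A) = (H.peel d S)^[n] A := by
  induction n generalizing A with
  | zero =>
    obtain rfl : A = ∅ := Finset.card_eq_zero.1 (Nat.le_zero.1 hn)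
    rfl
  | succ n ih =>
    by_cases h : H.peel d S A = A
    · rw [Function.iterate_fixed h, h]
    · have hlt : (H.peel d S A).card < A.card :=
        Finset.card_lt_card ((Finset.filter_subset _ _).ssubset_of_ne h)
      exact ih (by omega)

theorem iterate_peel_eq_core (hn : H.vertices.card ≤ n) :
    (H.peel d S)^[n] H.vertices = H.core d S := by
  refine (subset_core iterate_peel_subset fun v hv => ?_).antisymm ?_
  · rw [← peel_iterate_peel hn] at hv
    exact (Finset.mem_filter.1 hv).2
  · clear hn
    induction n with
    | zero => exact core_subset
    | succ n ih =>
      rw [Function.iterate_succ_apply']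
      exact fun v hv => Finset.mem_filter.2
        ⟨ih hv, (le_degree_core hv).trans (degree_le_degree subset_rfl ih v)⟩

end Core

section Covering

variable {H}

theorem card_inside_le (h : H.core (d + 1) S = ∅) (hA : A ⊆ H.vertices) :
    (H.inside S A).card ≤ d * A.card := by
  classical
  induction A using Finset.strongInduction with
  | H A ih =>
    rcases A.eq_empty_or_nonempty with rfl | hne
    · refine (Finset.card_eq_zero.2 (Finset.eq_empty_of_forall_notMem fun e he => ?_)).le
      obtain ⟨heS, heA⟩ := mem_inside.1 he
      exact (H.ends_nonempty e (mem_uncovered.1 heS).1).ne_empty (Finset.subset_empty.1 heA)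
    · obtain ⟨v, hv, hdeg⟩ := exists_degree_lt h hA hne
      have hrest := ih (A.erase v) (Finset.erase_ssubset hv) ((Finset.erase_subset v A).trans hA)
      have hsplit : H.inside S A ⊆
          H.inside S (A.erase v) ∪ (H.inside S A).filter fun e => v ∈ H.ends e := by
        intro e he
        by_cases hve : v ∈ H.ends e
        · exact Finset.mem_union_right _ (Finset.mem_filter.2 ⟨he, hve⟩)
        · exact Finset.mem_union_left _ (mem_inside.2
            ⟨(mem_inside.1 he).1, Finset.subset_erase.2 ⟨(mem_inside.1 he).2, hve⟩⟩)
      calc (H.inside S A).card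
          ≤ (H.inside S (A.erase v)).card + H.degree S A v :=
            (Finset.card_le_card hsplit).trans (Finset.card_union_le _ _)
        _ ≤ d * (A.erase v).card + d := by omega
        _ = d * A.card := by rw [← mul_add_one, Finset.card_erase_add_one hv]

theorem numUncovered_le (h : H.core (d + 1) S = ∅) (hR : R ⊆ H.vertices) (hcov : H.Covers R) :
    H.numUncovered S ≤ d * R.card := by
  refine le_trans (Finset.card_le_card fun o ho => ?_)
    ((Finset.card_image_le (f := H.output)).trans (card_inside_le h hR))
  obtain ⟨e, he, rfl⟩ := Finset.mem_image.1 ho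
  obtain ⟨e', he', heq, hsub⟩ := hcov e (mem_uncovered.1 he).1
  refine Finset.mem_image.2 ⟨e', mem_inside.2 ⟨mem_uncovered.2 ⟨he', ?_⟩, hsub⟩, heq⟩
  rw [heq]
  exact (mem_uncovered.1 he).2

theorem covers_of_core_one_eq_empty (h : H.core 1 S = ∅) : H.Covers S := by
  intro e he
  by_contra! hcon
  have hpos : 0 < (H.inside S (H.ends e)).card :=
    Finset.card_pos.2 ⟨e, mem_inside.2 ⟨mem_uncovered.2 ⟨he, hcon⟩, subset_rfl⟩⟩
  have := card_inside_le (d := 0) h (H.ends_subset e he)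
  omega

end Covering

section Potential

variable {H}

theorem card_mul_le_card_inside_mul (hdeg : ∀ v ∈ A, d ≤ H.degree S A v)
    (hb : ∀ e ∈ H.edges, (H.ends e).card ≤ b) : A.card * d ≤ (H.inside S A).card * b := by
  refine Finset.card_mul_le_card_mul (fun v e => v ∈ H.ends e) hdeg fun e he => ?_
  refine (Finset.card_le_card fun v hv => ?_).trans (hb e (mem_uncovered.1 (mem_inside.1 he).1).1)
  exact (Finset.mem_filter.1 hv).2

theorem card_inside_add_numUncovered_union_le
    (hinj : Set.InjOn H.output (H.inside S A : Set ε)) :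
    (H.inside S A).card + H.numUncovered (S ∪ A) ≤ H.numUncovered S := by
  rw [← Finset.card_image_of_injOn hinj, numUncovered, numUncovered,
    ← Finset.card_union_of_disjoint]
  · exact Finset.card_le_card (Finset.union_subset
      (Finset.image_subset_image (Finset.filter_subset _ _))
      (Finset.image_subset_image (uncovered_anti Finset.subset_union_left)))
  · rw [Finset.disjoint_left]
    intro o ho ho'
    obtain ⟨e, he, rfl⟩ := Finset.mem_image.1 ho
    obtain ⟨e', he', heq⟩ := Finset.mem_image.1 ho'
    obtain ⟨heS, heA⟩ := mem_inside.1 he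
    exact (mem_uncovered.1 he').2 e (mem_uncovered.1 heS).1 heq.symm
      (heA.trans Finset.subset_union_right)

theorem sub_div_le_harmonic_sub_harmonic {u u' : ℕ} (h : u' ≤ u) :
    ((u : ℚ) - u') / u ≤ harmonic u - harmonic u' := by
  induction u, h using Nat.le_induction with
  | base => simp
  | succ u hu ih =>
    rw [harmonic_succ]
    rcases Nat.eq_zero_or_pos u with rfl | hpos
    · obtain rfl : u' = 0 := Nat.le_zero.1 hu
      simp
    · have : (0 : ℚ) < u := by exact_mod_cast hpos
      have hle : (u' : ℚ) ≤ u := by exact_mod_cast hu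
      calc (((u + 1 : ℕ) : ℚ) - u') / ((u + 1 : ℕ) : ℚ)
          = (u - u') / (u + 1) + ((u + 1 : ℕ) : ℚ)⁻¹ := by
            push_cast
            field_simp
            ring
        _ ≤ (u - u') / u + ((u + 1 : ℕ) : ℚ)⁻¹ := by
            gcongr
            linarith
        _ ≤ _ := by linarith

theorem Unambiguous.injOn_inside (hH : H.Unambiguous) {c : C}
    (h : ∀ w ∈ A, H.color w = c) :
    Set.InjOn H.output (H.inside S A : Set ε) := by
  intro e he e' he' ho
  obtain ⟨hunc, hsub⟩ := mem_inside.1 he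
  obtain ⟨hunc', hsub'⟩ := mem_inside.1 he'
  have heE := (mem_uncovered.1 hunc).1
  have heE' := (mem_uncovered.1 hunc').1
  obtain ⟨w, hw⟩ := H.ends_nonempty e heE
  obtain ⟨w', hw'⟩ := H.ends_nonempty e' heE'
  exact hH e heE e' heE' w hw w' hw' ((h w (hsub hw)).trans (h w' (hsub' hw')).symm) ho

variable (H) in
/-- The potential of the greedy algorithm with respect to a solution of size `r`. -/
noncomputable def potential (b r : ℕ) (S : Finset V) : ℚ :=
  S.card + b * r * harmonic (H.numUncovered S)

theorem potential_union_le (hd : 0 < d) (hdeg : ∀ v ∈ A, d ≤ H.degree S A v)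
    (hb : ∀ e ∈ H.edges, (H.ends e).card ≤ b)
    (hinj : Set.InjOn H.output (H.inside S A : Set ε)) (hr : H.numUncovered S ≤ d * r) :
    H.potential b r (S ∪ A) ≤ H.potential b r S := by
  have hA : A.card * d + H.numUncovered (S ∪ A) * b ≤ H.numUncovered S * b :=
    (add_le_add_left (card_mul_le_card_inside_mul hdeg hb) _).trans
      ((add_mul _ _ b).symm.trans_le
        (Nat.mul_le_mul_right b (card_inside_add_numUncovered_union_le hinj)))
  have hharm := sub_div_le_harmonic_sub_harmonic
    (numUncovered_anti (H := H) (Finset.subset_union_left (s₁ := S) (s₂ := A)))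
  unfold potential
  generalize H.numUncovered S = u at *
  generalize H.numUncovered (S ∪ A) = u' at *
  have hcard : (A.card : ℚ) ≤ b * r * ((u - u') / u) := by
    rcases Nat.eq_zero_or_pos u with rfl | hu
    · have : A.card * d = 0 := by omega
      simp [(mul_eq_zero.1 this).resolve_right hd.ne']
    · have hA' : (A.card : ℚ) * d + u' * b ≤ u * b := by exact_mod_cast hA
      have hr' : (u : ℚ) ≤ d * r := by exact_mod_cast hr
      rw [← mul_div_assoc, le_div_iff₀ (by exact_mod_cast hu)]
      calc (A.card : ℚ) * u ≤ A.card * (d * r) := by gcongr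
        _ = (A.card * d) * r := by ring
        _ ≤ (u * b - u' * b) * r := by gcongr; linarith
        _ = b * r * (u - u') := by ring
  calc ((S ∪ A).card : ℚ) + b * r * harmonic u'
      ≤ (S.card + A.card) + b * r * harmonic u' := by
        gcongr
        exact_mod_cast Finset.card_union_le S A
    _ ≤ (S.card + b * r * (harmonic u - harmonic u')) + b * r * harmonic u' := by
        gcongr
        exact hcard.trans (by gcongr)
    _ = S.card + b * r * harmonic u := by ring

theorem harmonic_numUncovered_le :
    (harmonic (H.numUncovered S) : ℝ) ≤ 1 + Real.log H.edges.card := by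
  refine (harmonic_le_one_add_log _).trans ?_
  rcases Nat.eq_zero_or_pos (H.numUncovered S) with h | h
  · rw [h, Nat.cast_zero, Real.log_zero]
    exact add_le_add_right (Real.log_natCast_nonneg _) 1
  · gcongr
    exact Finset.card_image_le.trans (Finset.card_le_card (Finset.filter_subset _ _))

end Potential

section Greedy

variable [DecidableEq C] {H} {v : V}

theorem subset_pick : S ⊆ H.pick d S v := Finset.subset_union_left

theorem subset_round : S ⊆ H.round l d S := by
  induction l generalizing S with
  | nil => exact subset_rfl
  | cons v l ih => exact subset_pick.trans ih

theorem notMem_core_pick (hd : 0 < d) : v ∉ H.core d (H.pick d S v) := by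
  intro hv
  obtain ⟨e, he, hve⟩ := exists_inside_core hd hv
  obtain ⟨hunc, hsub⟩ := mem_inside.1 he
  obtain ⟨heE, hcov⟩ := mem_uncovered.1 hunc
  refine hcov e heE rfl fun w hw => Finset.mem_union_right _ (Finset.mem_filter.2
    ⟨core_anti subset_pick (hsub hw), core_anti subset_pick hv, H.color_eq e heE w hw v hve⟩)

theorem le_degree_colorClass (h : A = (H.core d S).filter fun w => H.color w = H.color v) :
    ∀ w ∈ A, d ≤ H.degree S A w := by
  subst h
  intro w hw
  obtain ⟨hw, hcol⟩ := Finset.mem_filter.1 hw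
  refine (le_degree_core hw).trans (Finset.card_le_card fun e he => ?_)
  obtain ⟨he, hwe⟩ := Finset.mem_filter.1 he
  obtain ⟨hunc, hsub⟩ := mem_inside.1 he
  exact Finset.mem_filter.2 ⟨mem_inside.2 ⟨hunc, fun z hz => Finset.mem_filter.2
    ⟨hsub hz, (H.color_eq e (mem_uncovered.1 hunc).1 z hz w hwe).trans hcol⟩⟩, hwe⟩

theorem potential_pick_le (hH : H.Unambiguous) (hd : 0 < d)
    (hb : ∀ e ∈ H.edges, (H.ends e).card ≤ b) (hr : H.numUncovered S ≤ d * r) :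
    H.potential b r (H.pick d S v) ≤ H.potential b r S := by
  by_cases hv : v ∈ H.core d S
  · simp only [pick, hv, true_and]
    exact potential_union_le hd (le_degree_colorClass rfl) hb
      (hH.injOn_inside fun w hw => (Finset.mem_filter.1 hw).2) hr
  · simp only [pick, hv, false_and, Finset.filter_false, Finset.union_empty, le_refl]

theorem potential_round_le (hH : H.Unambiguous) (hd : 0 < d)
    (hb : ∀ e ∈ H.edges, (H.ends e).card ≤ b) (hr : H.numUncovered S ≤ d * r) :
    H.potential b r (H.round l d S) ≤ H.potential b r S := by
  induction l generalizing S with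
  | nil => exact le_rfl
  | cons v l ih =>
    exact (ih ((numUncovered_anti subset_pick).trans hr)).trans (potential_pick_le hH hd hb hr)

theorem core_round_eq_empty (hd : 0 < d) (hl : ∀ e ∈ H.edges, ∃ v ∈ l, v ∈ H.ends e) :
    H.core d (H.round l d S) = ∅ := by
  refine Finset.eq_empty_of_forall_notMem fun w hw => ?_
  obtain ⟨e, he, -⟩ := exists_inside_core hd hw
  obtain ⟨hunc, hsub⟩ := mem_inside.1 he
  obtain ⟨v, hvl, hve⟩ := hl e (mem_uncovered.1 hunc).1
  obtain ⟨l₁, l₂, rfl⟩ := List.append_of_mem hvl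
  have hv := hsub hve
  rw [round, List.foldl_append, List.foldl_cons] at hv
  exact notMem_core_pick hd (core_anti (subset_round (l := l₂)) hv)

theorem core_one_greedy_eq_empty (hl : ∀ e ∈ H.edges, ∃ v ∈ l, v ∈ H.ends e)
    (hS : H.core (M + 1) S = ∅) : H.core 1 (H.greedy l M S) = ∅ := by
  induction M generalizing S with
  | zero => exact hS
  | succ M ih => exact ih (core_round_eq_empty M.succ_pos hl)

theorem potential_greedy_le (hH : H.Unambiguous) (hb : ∀ e ∈ H.edges, (H.ends e).card ≤ b)
    (hl : ∀ e ∈ H.edges, ∃ v ∈ l, v ∈ H.ends e) (hR : R ⊆ H.vertices) (hcov : H.Covers R)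
    (hS : H.core (M + 1) S = ∅) :
    H.potential b R.card (H.greedy l M S) ≤ H.potential b R.card S := by
  induction M generalizing S with
  | zero => exact le_rfl
  | succ M ih =>
    exact (ih (core_round_eq_empty M.succ_pos hl)).trans
      (potential_round_le hH M.succ_pos hb (numUncovered_le hS hR hcov))

theorem covers_greedy (hl : ∀ e ∈ H.edges, ∃ v ∈ l, v ∈ H.ends e) (hM : H.edges.card ≤ M) :
    H.Covers (H.greedy l M ∅) :=
  covers_of_core_one_eq_empty
    (core_one_greedy_eq_empty hl (core_eq_empty_of_card_lt (Nat.lt_succ_of_le hM)))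

theorem card_greedy_le (hH : H.Unambiguous) (hb : ∀ e ∈ H.edges, (H.ends e).card ≤ b)
    (hl : ∀ e ∈ H.edges, ∃ v ∈ l, v ∈ H.ends e) (hM : H.edges.card ≤ M)
    (hR : R ⊆ H.vertices) (hcov : H.Covers R) :
    ((H.greedy l M ∅).card : ℝ) ≤ b * (1 + Real.log H.edges.card) * R.card := by
  set G := H.greedy l M ∅
  have hpot : H.potential b R.card G ≤ H.potential b R.card ∅ :=
    potential_greedy_le hH hb hl hR hcov (core_eq_empty_of_card_lt (Nat.lt_succ_of_le hM))
  have hnonneg : (0 : ℚ) ≤ b * R.card * harmonic (H.numUncovered G) := by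
    rw [harmonic]
    positivity
  have hcard : (G.card : ℚ) ≤ b * R.card * harmonic (H.numUncovered ∅) := by
    rw [potential, potential, Finset.card_empty, Nat.cast_zero, zero_add] at hpot
    linarith
  calc (G.card : ℝ) ≤ b * R.card * (harmonic (H.numUncovered ∅) : ℝ) := by exact_mod_cast hcard
    _ ≤ b * R.card * (1 + Real.log H.edges.card) := by
      gcongr
      exact harmonic_numUncovered_le
    _ = _ := by ring

variable (H) in
theorem greedy_eq_foldl (l : List V) (M : ℕ) (S : Finset V) :
    H.greedy l M S = (List.range M).foldl (fun S j => H.round l (M - j) S) S := by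
  induction M generalizing S with
  | zero => rfl
  | succ M ih =>
    rw [List.range_succ_eq_map, List.foldl_cons, List.foldl_map, greedy, ih]
    simp only [Nat.succ_eq_add_one, Nat.add_sub_add_right, Nat.sub_zero]

end Greedy

end ColoredHypergraph

namespace CQ

open RAM

section Hypergraph

variable (Q : CQ) {β : ℕ} {i i₀ : Fin Q.numRels} (hi₀ : β ∈ Q.attr i₀) (I : Input Q.numRels)

/-- The value of attribute `a` in row `v`, which is meaningful if `a` is an attribute of the
relation. The values of a row are ordered by attributes. -/
def entry (v : Fin Q.numRels × ℕ) (a : ℕ) : ℕ :=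
  I.data v.1 (v.2 * (Q.attr v.1).card + {b ∈ Q.attr v.1 | b < a}.card)

/-- The combinations of a row of each table that join. -/
def edges : Finset (Fin Q.numRels → ℕ) :=
  {J ∈ Fintype.piFinset fun _ => Finset.range I.size | (∀ i, J i < I.len i) ∧
    ∀ i i' (a : ↥(Q.attr i ∩ Q.attr i')), Q.entry I (i, J i) a = Q.entry I (i', J i') a}

/-- The hypergraph of a query with the non-output attribute `β`: the edges are the elements of the
join, the ends of an edge are its rows with a value for `β`, and this value is their colour. -/
def hypergraph : ColoredHypergraph (Fin Q.numRels → ℕ) (Fin Q.numRels × ℕ)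
    ((i : Fin Q.numRels) → ↥(Q.attr i ∩ Q.head) → ℕ) ℕ where
  vertices := I.rows
  edges := Q.edges I
  ends J := (Finset.univ.filter fun i => β ∈ Q.attr i).image fun i => (i, J i)
  output J i a := Q.entry I (i, J i) a
  color v := Q.entry I v β
  ends_nonempty J _ := ⟨(i₀, J i₀), Finset.mem_image_of_mem _ (by simpa using hi₀)⟩
  ends_subset J hJ := Finset.image_subset_iff.2 fun i _ => Input.mem_rows.2
    (Finset.mem_range.1 (Fintype.mem_piFinset.1 (Finset.mem_filter.1 hJ).1 i))
  color_eq J hJ := by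
    simp only [Finset.forall_mem_image, Finset.mem_filter, Finset.mem_univ, true_and]
    exact fun i hi i' hi' =>
      (Finset.mem_filter.1 hJ).2.2 i i' ⟨β, Finset.mem_inter.2 ⟨hi, hi'⟩⟩

/-- The rows of table `i₀`, as seeds for the greedy algorithm. -/
def seeds (i₀ : Fin Q.numRels) : List (Fin Q.numRels × ℕ) :=
  (List.range I.size).map fun j => (i₀, j)

/-- The rows that the greedy algorithm chooses. -/
def chosen : Rows Q.numRels :=
  (Q.hypergraph hi₀ I).greedy (Q.seeds I i₀) (I.size ^ Q.numRels) ∅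

/-- The rows of the solution: the chosen ones, and for the relations without the non-output
attribute `β` all rows that take part in the join. -/
def kept : Rows Q.numRels :=
  {v ∈ I.rows | v.2 < I.len v.1 ∧
    if β ∈ Q.attr v.1 then v ∈ Q.chosen hi₀ I else ∃ J ∈ Q.edges I, J v.1 = v.2}

variable {Q I} {J : Fin Q.numRels → ℕ}

theorem ends_subset_iff {S : Rows Q.numRels} : (Q.hypergraph hi₀ I).ends J ⊆ S ↔
    ∀ i : {i // β ∈ Q.attr i}, (i.1, J i) ∈ S := by
  simp only [hypergraph, Finset.image_subset_iff, Finset.mem_filter, Finset.mem_univ, true_and,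
    Subtype.forall]

theorem mem_ends_iff {v : Fin Q.numRels × ℕ} : v ∈ (Q.hypergraph hi₀ I).ends J ↔
    β ∈ Q.attr v.1 ∧ J v.1 = v.2 := by
  obtain ⟨i, j⟩ := v
  simp [hypergraph]

end Hypergraph

section Computability

variable {Q : CQ} {β : ℕ} {i₀ : Fin Q.numRels} {hi₀ : β ∈ Q.attr i₀} {ι κ : Type} {c c' : κ}
  {f d : Input Q.numRels → (ι → ℕ) → (κ → Rows Q.numRels) → ℕ}
  {J J' : Fin Q.numRels → Input Q.numRels → (ι → ℕ) → (κ → Rows Q.numRels) → ℕ}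

theorem polyNum_entry (i : Fin Q.numRels) (hf : PolyNum f) (a : ℕ) :
    PolyNum fun I y X => Q.entry I (i, f I y X) a :=
  (PolyNum.data i ((hf.mul_const (Q.attr i).card).add
    (.const {b ∈ Q.attr i | b < a}.card))).congr fun _ _ _ _ => rfl

theorem polyPred_mem_edges (hJ : ∀ i, PolyNum (J i)) :
    PolyPred fun I y X => (fun i => J i I y X) ∈ Q.edges I := by
  refine ((PolyPred.forall_finite fun i => .lt (hJ i) .size).and
    ((PolyPred.forall_finite fun i => .lt (hJ i) (.len i)).and
    (PolyPred.forall_finite fun i => PolyPred.forall_finite fun i' => PolyPred.forall_finite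
      fun a : ↥(Q.attr i ∩ Q.attr i') =>
        .eq (polyNum_entry i (hJ i) a) (polyNum_entry i' (hJ i') a)))).congr fun I y X _ => ?_
  simp only [edges, Finset.mem_filter, Fintype.mem_piFinset, Finset.mem_range]

theorem polyPred_output_eq (hJ : ∀ i, PolyNum (J i)) (hJ' : ∀ i, PolyNum (J' i)) :
    PolyPred fun I y X => (Q.hypergraph hi₀ I).output (fun i => J i I y X) =
      (Q.hypergraph hi₀ I).output fun i => J' i I y X :=
  (PolyPred.forall_finite fun i => PolyPred.forall_finite fun a : ↥(Q.attr i ∩ Q.head) =>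
    .eq (polyNum_entry i (hJ i) a) (polyNum_entry i (hJ' i) a)).congr fun I y X _ => by
      simp only [funext_iff, hypergraph]

theorem polyPred_ends_subset (hJ : ∀ i, PolyNum (J i)) (c : κ) :
    PolyPred fun I y X => (Q.hypergraph hi₀ I).ends (fun i => J i I y X) ⊆ X c :=
  (PolyPred.forall_finite fun i : {i // β ∈ Q.attr i} => PolyPred.mem c i.1 (hJ i)).congr
    fun _ _ _ _ => ends_subset_iff hi₀

theorem mem_piFinset_of_mem_edges {I : Input Q.numRels} {J : Fin Q.numRels → ℕ}
    (hJ : J ∈ Q.edges I) : J ∈ Fintype.piFinset fun _ => Finset.range I.size :=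
  (Finset.mem_filter.1 hJ).1

theorem polyPred_mem_uncovered (hJ : ∀ i, PolyNum (J i)) (c : κ) : PolyPred fun I y X =>
    (fun i => J i I y X) ∈ (Q.hypergraph hi₀ I).uncovered (X c) := by
  have hJr (i) := (hJ i).reindex (Sum.inl : ι → ι ⊕ Fin Q.numRels) (id : κ → κ)
  have hnum (i : Fin Q.numRels) : PolyNum fun (_ : Input Q.numRels)
      (y : ι ⊕ Fin Q.numRels → ℕ) (_ : κ → Rows Q.numRels) => y (.inr i) := .num _
  refine ((polyPred_mem_edges hJ).and (PolyPred.exists_pi (p := fun I y X J' => J' ∈ Q.edges I ∧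
    (Q.hypergraph hi₀ I).output J' = (Q.hypergraph hi₀ I).output (fun i => J i I y X) ∧
    (Q.hypergraph hi₀ I).ends J' ⊆ X c) ((polyPred_mem_edges hnum).and
    ((polyPred_output_eq (hi₀ := hi₀) hnum hJr).and
      (polyPred_ends_subset (hi₀ := hi₀) hnum c)))).not).congr fun I y X _ => ?_
  rw [ColoredHypergraph.mem_uncovered]
  refine and_congr_right fun _ => ⟨fun h ⟨J', _, hJ', ho, hs⟩ => h J' hJ' ho hs,
    fun h J' hJ' ho hs => h ⟨J', mem_piFinset_of_mem_edges hJ', hJ', ho, hs⟩⟩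

theorem polyNum_degree (c c' : κ) (i : Fin Q.numRels) (hf : PolyNum f) :
    PolyNum fun I y X => (Q.hypergraph hi₀ I).degree (X c) (X c') (i, f I y X) := by
  have hfr := hf.reindex (Sum.inl : ι → ι ⊕ Fin Q.numRels) (id : κ → κ)
  have hnum (i : Fin Q.numRels) : PolyNum fun (_ : Input Q.numRels)
      (y : ι ⊕ Fin Q.numRels → ℕ) (_ : κ → Rows Q.numRels) => y (.inr i) := .num _
  refine (PolyNum.sum_pi (f := fun I y X J =>
    if (J ∈ (Q.hypergraph hi₀ I).uncovered (X c) ∧ (Q.hypergraph hi₀ I).ends J ⊆ X c') ∧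
      (β ∈ Q.attr i ∧ J i = f I y X) then 1 else 0)
    (.ite (((polyPred_mem_uncovered hnum c).and (polyPred_ends_subset hnum c')).and
      ((PolyPred.const _).and (.eq (hnum i) hfr))) (.const 1) (.const 0))).congr fun I y X _ => ?_
  rw [ColoredHypergraph.degree, Finset.sum_boole, Nat.cast_id]
  congr 1
  ext J
  rw [Finset.mem_filter, Finset.mem_filter, ColoredHypergraph.mem_inside, mem_ends_iff]
  exact ⟨fun h => ⟨mem_piFinset_of_mem_edges (ColoredHypergraph.mem_uncovered.1 h.1.1).1, h⟩,
    fun h => h.2⟩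

theorem polySet_peel (hd : PolyNum d) (c c' : κ) :
    PolySet fun I y X => (Q.hypergraph hi₀ I).peel (d I y X) (X c) (X c') := by
  refine (PolySet.filter (p := fun I y X v =>
    v ∈ X c' ∧ d I y X ≤ (Q.hypergraph hi₀ I).degree (X c) (X c') v) fun i =>
    (PolyPred.mem c' i (.num none)).and
      (.le (hd.reindex some id) (polyNum_degree c c' i (.num none)))).congr fun I y X hX => ?_
  rw [ColoredHypergraph.peel, ← Finset.filter_filter, Finset.filter_mem_eq_inter,
    Finset.inter_eq_right.2 (hX c')]

theorem polySet_core (hd : PolyNum d) (c : κ) :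
    PolySet fun I y X => (Q.hypergraph hi₀ I).core (d I y X) (X c) := by
  refine (PolySet.foldl_range (n := fun I _ _ => I.size * Q.numRels) (PolyNum.size.mul_const _)
    (q := .X * .C Q.numRels) (fun _ _ _ => by simp)
    (F₀ := fun I _ _ => {_v ∈ I.rows | True}) (PolySet.filter fun _ => PolyPred.const True)
    (F := fun I y X _ A => (Q.hypergraph hi₀ I).peel (d I y X) (X c) A)
    (polySet_peel (hd.reindex some some) (some c) none)).congr fun I y X _ => ?_
  rw [List.foldl_const, List.length_range, Finset.filter_true,
    ← ColoredHypergraph.iterate_peel_eq_core (n := I.size * Q.numRels)]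
  · rfl
  · simp [hypergraph, Input.rows, mul_comm]

theorem polySet_pick (hd : PolyNum d) (hf : PolyNum f) (c : κ) : PolySet fun I y X =>
    (Q.hypergraph hi₀ I).pick (d I y X) (X c) (i₀, f I y X) := by
  refine ((polySet_core (hi₀ := hi₀) hd c).letSet (G := fun I y X C => {w ∈ I.rows | w ∈ X c ∨
      (w ∈ C ∧ (i₀, f I y X) ∈ C ∧ Q.entry I w β = Q.entry I (i₀, f I y X) β)})
    (PolySet.filter fun i => (PolyPred.mem (some c) i (.num none)).or
      ((PolyPred.mem none i (.num none)).and
      ((PolyPred.mem none i₀ (hf.reindex some some)).and (.eq (polyNum_entry i (.num none) β)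
        (polyNum_entry i₀ (hf.reindex some some) β)))))).congr fun I y X hX => ?_
  ext w
  rw [ColoredHypergraph.pick, Finset.mem_union, Finset.mem_filter, Finset.mem_filter]
  refine ⟨fun h => ⟨h.elim (@hX c w) fun h => ColoredHypergraph.core_subset h.1, h⟩,
    fun h => h.2⟩

theorem polySet_round (hd : PolyNum d) (c : κ) : PolySet fun I y X =>
    (Q.hypergraph hi₀ I).round (Q.seeds I i₀) (d I y X) (X c) := by
  refine (PolySet.foldl_range PolyNum.size (q := .X) (fun _ _ _ => by simp) (.set c)
    (F := fun I y X j S => (Q.hypergraph hi₀ I).pick (d I y X) S (i₀, j))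
    (polySet_pick (hd.reindex some some) (.num none) none)).congr fun I y X _ => ?_
  rw [ColoredHypergraph.round, seeds, List.foldl_map]

theorem polySet_chosen :
    PolySet fun I (_ : ι → ℕ) (_ : κ → Rows Q.numRels) => Q.chosen hi₀ I := by
  refine (PolySet.foldl_range (PolyNum.size_pow Q.numRels) (q := .X ^ Q.numRels)
    (fun _ _ _ => by simp)
    (F₀ := fun I _ _ => {_v ∈ I.rows | False}) (PolySet.filter fun _ => PolyPred.const False)
    (F := fun I _ _ j S =>
      (Q.hypergraph hi₀ I).round (Q.seeds I i₀) (I.size ^ Q.numRels - j) S)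
    (polySet_round ((PolyNum.size_pow _).sub (.num none)) none)).congr fun I y X _ => ?_
  rw [chosen, ColoredHypergraph.greedy_eq_foldl, Finset.filter_false]

theorem polyPred_exists_edge (i : Fin Q.numRels) (hf : PolyNum f) :
    PolyPred fun I y X => ∃ J ∈ Q.edges I, J i = f I y X := by
  have hnum (i : Fin Q.numRels) : PolyNum fun (_ : Input Q.numRels)
      (y : ι ⊕ Fin Q.numRels → ℕ) (_ : κ → Rows Q.numRels) => y (.inr i) := .num _
  refine (PolyPred.exists_pi (p := fun I y X J => J ∈ Q.edges I ∧ J i = f I y X)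
    ((polyPred_mem_edges hnum).and (.eq (hnum i) (hf.reindex Sum.inl id)))).congr
    fun I y X _ => ⟨fun ⟨J, h⟩ => ⟨J, mem_piFinset_of_mem_edges h.1, h⟩, fun ⟨J, _, h⟩ => ⟨J, h⟩⟩

theorem polySet_kept :
    PolySet fun I (_ : ι → ℕ) (_ : κ → Rows Q.numRels) => Q.kept hi₀ I := by
  refine (polySet_chosen (hi₀ := hi₀)).letSet (G := fun I _ _ S => {v ∈ I.rows | v.2 < I.len v.1 ∧
    if β ∈ Q.attr v.1 then v ∈ S else ∃ J ∈ Q.edges I, J v.1 = v.2})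
    (PolySet.filter fun i => (PolyPred.lt (.num none) (.len i)).and ?_)
  by_cases hβ : β ∈ Q.attr i
  · simpa only [hβ, if_true] using PolyPred.mem none i (.num none)
  · simpa only [hβ, if_false] using polyPred_exists_edge i (.num none)

end Computability

section Cells

variable {X : Finset ℕ} {l : List (Tuple X)} {j : ℕ}

theorem length_row (t : Tuple X) : (row t).length = X.card := List.length_ofFn

theorem length_cells (l : List (Tuple X)) : (cells l).length = l.length * X.card := by
  simp only [cells, List.length_flatMap, length_row, List.map_const', List.sum_replicate,
    smul_eq_mul]

theorem getD_cells (hj : j < l.length) (c : Fin X.card) :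
    (cells l).getD (j * X.card + c) 0 = l.getD j 0 (X.orderIsoOfFin rfl c) := by
  induction l generalizing j with
  | nil => exact absurd hj (Nat.not_lt_zero j)
  | cons t l ih =>
    rw [cells, List.flatMap_cons]
    cases j with
    | zero =>
      have hc : (c : ℕ) < (row t).length := (length_row t).symm ▸ c.isLt
      rw [zero_mul, zero_add, List.getD_append _ _ _ _ hc, List.getD_cons_zero,
        List.getD_eq_getElem _ _ hc]
      exact List.getElem_ofFn _
    | succ j =>
      have hsucc : (j + 1) * X.card + c = (row t).length + (j * X.card + c) := by
        rw [length_row]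
        ring
      rw [hsucc, List.getD_append_right _ _ _ _ (Nat.le_add_right _ _), Nat.add_sub_cancel_left,
        List.getD_cons_succ]
      exact ih (Nat.lt_of_succ_lt_succ hj)

theorem card_filter_lt_orderIsoOfFin (X : Finset ℕ) (c : Fin X.card) :
    {b ∈ X | b < (X.orderIsoOfFin rfl c : ℕ)}.card = c := by
  have hmap : {b ∈ X | b < (X.orderIsoOfFin rfl c : ℕ)} =
      (Finset.Iio c).map (X.orderEmbOfFin rfl).toEmbedding := by
    ext b
    simp only [Finset.mem_filter, Finset.mem_map, Finset.mem_Iio, RelEmbedding.coe_toEmbedding]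
    refine ⟨fun ⟨hb, hlt⟩ => ?_, ?_⟩
    · refine ⟨(X.orderIsoOfFin rfl).symm ⟨b, hb⟩, ?_, ?_⟩
      · exact (OrderIso.symm_apply_lt _).2 hlt
      · rw [← Finset.coe_orderIsoOfFin_apply, OrderIso.apply_symm_apply]
    · rintro ⟨c', hc', rfl⟩
      exact ⟨Finset.orderEmbOfFin_mem _ _ _, (X.orderEmbOfFin rfl).strictMono hc'⟩
  rw [hmap, Finset.card_map, Fin.card_Iio]

theorem getD_cells_card_filter_lt (hj : j < l.length) (a : X) :
    (cells l).getD (j * X.card + {b ∈ X | b < (a : ℕ)}.card) 0 = l.getD j 0 a := by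
  obtain ⟨c, rfl⟩ := (X.orderIsoOfFin rfl).surjective a
  rw [card_filter_lt_orderIsoOfFin, getD_cells hj]

end Cells

section Tables

variable {Q : CQ} {T : Q.Tables} {D : Q.Database} {S : Rows Q.numRels} {i : Fin Q.numRels}
  {j j' : ℕ}

/-- The memory contents of given tables, as an input of size `∑ i, (T i).length`. -/
def Tables.input (T : Q.Tables) : Input Q.numRels where
  size := ∑ i, (T i).length
  len i := (T i).length
  data i p := (cells (T i)).getD p 0

/-- The database that is listed by given tables. -/
def Tables.database (T : Q.Tables) : Q.Database := fun i => (T i).toFinset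

/-- The tables that consist of the rows in `S`, in the same order. -/
def Tables.select (T : Q.Tables) (S : Rows Q.numRels) : Q.Tables := fun i =>
  ((List.range (T i).length).filter fun j => (i, j) ∈ S).map fun j => (T i).getD j 0

theorem length_le_size_input (T : Q.Tables) (i : Fin Q.numRels) :
    (T i).length ≤ T.input.size :=
  Finset.single_le_sum (f := fun i => (T i).length) (fun _ _ => Nat.zero_le _) (Finset.mem_univ i)

theorem Lists.size_eq (hT : Q.Lists T D) : D.size = T.input.size :=
  Finset.sum_congr rfl fun i _ => by rw [← (hT i).2, List.toFinset_card_of_nodup (hT i).1]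

theorem Lists.getD_mem (hT : Q.Lists T D) (hj : j < (T i).length) : (T i).getD j 0 ∈ D i := by
  rw [← (hT i).2, List.mem_toFinset, List.getD_eq_getElem _ _ hj]
  exact List.getElem_mem hj

theorem Lists.idxOf_getD (hT : Q.Lists T D) (hj : j < (T i).length) :
    (T i).idxOf ((T i).getD j 0) = j := by
  rw [List.getD_eq_getElem _ _ hj, (hT i).1.idxOf_getElem]

theorem Lists.getD_inj (hT : Q.Lists T D) (hj : j < (T i).length) (hj' : j' < (T i).length)
    (h : (T i).getD j 0 = (T i).getD j' 0) : j = j' := by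
  rw [← hT.idxOf_getD hj, h, hT.idxOf_getD hj']

theorem mem_database_select {t : Tuple (Q.attr i)} : t ∈ (T.select S).database i ↔
    ∃ j < (T i).length, (i, j) ∈ S ∧ (T i).getD j 0 = t := by
  simp only [Tables.database, Tables.select, List.mem_toFinset, List.mem_map, List.mem_filter,
    List.mem_range, decide_eq_true_eq, and_assoc]

theorem Lists.select (hT : Q.Lists T D) (S : Rows Q.numRels) :
    Q.Lists (T.select S) (T.select S).database := fun _ =>
  ⟨(List.nodup_range.filter _).map_on fun _ hj _ hj' h =>
    hT.getD_inj (List.mem_range.1 (List.mem_filter.1 hj).1)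
      (List.mem_range.1 (List.mem_filter.1 hj').1) h, rfl⟩

theorem database_select_subset (hT : Q.Lists T D) (S : Rows Q.numRels) (i : Fin Q.numRels) :
    (T.select S).database i ⊆ D i := fun _ ht => by
  obtain ⟨j, hj, -, rfl⟩ := mem_database_select.1 ht
  exact hT.getD_mem hj

theorem totalInput_inputState (T : Q.Tables) :
    (Q.inputState T).totalInput Q.numRels = T.input := by
  simp only [State.totalInput, inputState, Tables.input, Fin.is_lt, dite_true, Fin.eta]

end Tables

section Output

variable {Q : CQ} {T : Q.Tables} {S : Rows Q.numRels} {s : State} {p : ℕ → Prop}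
  [DecidablePred p] {n N N' : ℕ}

theorem count_eq_length_filter_range (p : ℕ → Prop) [DecidablePred p] (N : ℕ) :
    Nat.count p N = ((List.range N).filter (p ·)).length := by
  rw [Nat.count, List.countP_eq_length_filter]

theorem count_getElem_filter_range (h : n < ((List.range N).filter (p ·)).length) :
    Nat.count p ((List.range N).filter (p ·))[n] = n := by
  induction N with
  | zero => exact absurd h (Nat.not_lt_zero n)
  | succ N ih =>
    simp only [List.range_succ, List.filter_append] at h ⊢
    by_cases hn : n < ((List.range N).filter (p ·)).length
    · rw [List.getElem_append_left hn]
      exact ih hn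
    · by_cases hp : p N
      · have hlast : n = ((List.range N).filter (p ·)).length := by
          simp only [hp, decide_true, List.filter_cons_of_pos, List.filter_nil, List.length_append,
            List.length_singleton] at h
          omega
        subst hlast
        simp only [hp, decide_true, List.filter_cons_of_pos, List.filter_nil,
          List.getElem_concat_length]
        exact count_eq_length_filter_range p N
      · simp only [hp, decide_false, Bool.false_eq_true, not_false_eq_true,
          List.filter_cons_of_neg, List.filter_nil, List.append_nil] at h
        exact absurd h hn

theorem count_eq_of_lt (hN : N ≤ N') (hp : ∀ j, p j → j < N) :
    Nat.count p N' = Nat.count p N := by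
  rw [Nat.count_eq_card_filter_range, Nat.count_eq_card_filter_range]
  congr 1
  ext j
  simp only [Finset.mem_filter, Finset.mem_range]
  exact ⟨fun h => ⟨hp j h.2, h.2⟩, fun h => ⟨h.1.trans_le hN, h.2⟩⟩

theorem outputs_select (hS : ∀ v ∈ S, v.2 < (T v.1).length)
    (hs : ∀ i, T.input.IsCompaction (s.input Q.numRels) i (Q.attr i).card fun j => (i, j) ∈ S) :
    Q.Outputs s (T.select S) := by
  intro i
  set l := (List.range (T i).length).filter fun j => (i, j) ∈ S with hl
  have hlen : (T.select S i).length = l.length := List.length_map _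
  refine ⟨?_, fun q hq => ?_⟩
  · rw [hlen, hl, ← count_eq_length_filter_range fun j => (i, j) ∈ S,
      ← count_eq_of_lt (length_le_size_input T i) fun j hj => hS (i, j) hj]
    exact (hs i).1
  · rw [length_cells, hlen] at hq
    have hw : 0 < (Q.attr i).card := Nat.pos_of_mul_pos_left (Nat.zero_le q |>.trans_lt hq)
    set c : Fin (Q.attr i).card := ⟨q % (Q.attr i).card, Nat.mod_lt _ hw⟩
    set n := q / (Q.attr i).card
    have hn : n < l.length := Nat.div_lt_of_lt_mul (mul_comm l.length _ ▸ hq)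
    obtain ⟨hr, hrS⟩ := List.mem_filter.1 (List.getElem_mem hn)
    have hr := List.mem_range.1 hr
    have hcell := (hs i).2 l[n] (hr.trans_le (length_le_size_input T i))
      (of_decide_eq_true hrS) c c.isLt
    rw [count_getElem_filter_range hn] at hcell
    have hq : q = n * (Q.attr i).card + c := (Nat.div_add_mod' q _).symm
    rw [hq, getD_cells (hlen.symm ▸ hn), List.getD_eq_getElem _ _ (hlen.symm ▸ hn)]
    have hrow : (T.select S i)[n]'(hlen.symm ▸ hn) = (T i).getD l[n] 0 := List.getElem_map _
    exact hrow ▸ hcell.trans (getD_cells hr c)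

end Output

section Joins

variable {Q : CQ} {β : ℕ} {i i₀ : Fin Q.numRels} (hi₀ : β ∈ Q.attr i₀) {T : Q.Tables}
  {D D' : Q.Database} {J J' : Fin Q.numRels → ℕ} {s s' : Tuple Q.attrs}

/-- Row `J i` of each table `i` is the projection of the tuple `s`. -/
def Joins (T : Q.Tables) (J : Fin Q.numRels → ℕ) (s : Tuple Q.attrs) : Prop :=
  ∀ i, J i < (T i).length ∧ (T i).getD (J i) 0 = proj (Q.attr_subset_attrs i) s

theorem entry_input {v : Fin Q.numRels × ℕ} (hv : v.2 < (T v.1).length) (a : Q.attr v.1) :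
    Q.entry T.input v a = (T v.1).getD v.2 0 a :=
  getD_cells_card_filter_lt hv a

theorem Joins.entry_eq (hs : Joins T J s) (a : Q.attrs) (ha : a.1 ∈ Q.attr i) :
    Q.entry T.input (i, J i) a = s a := by
  rw [entry_input (v := (i, J i)) (hs i).1 ⟨a, ha⟩, (hs i).2, proj]

theorem Joins.mem_edges (hs : Joins T J s) : J ∈ Q.edges T.input := by
  refine Finset.mem_filter.2 ⟨Fintype.mem_piFinset.2 fun i => Finset.mem_range.2
    ((hs i).1.trans_le (length_le_size_input T i)), fun i => (hs i).1, fun i i' a => ?_⟩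
  obtain ⟨hi, hi'⟩ := Finset.mem_inter.1 a.2
  have ha := Q.attr_subset_attrs i hi
  rw [hs.entry_eq ⟨a, ha⟩ hi, hs.entry_eq ⟨a, ha⟩ hi']

theorem exists_joins_of_mem_edges (hJ : J ∈ Q.edges T.input) : ∃ s, Joins T J s := by
  obtain ⟨-, hlt, heq⟩ := Finset.mem_filter.1 hJ
  have hrel (a : Q.attrs) : ∃ i, a.1 ∈ Q.attr i := by
    simpa only [attrs, Finset.mem_biUnion, Finset.mem_univ, true_and] using a.2
  choose i hi using hrel
  refine ⟨fun a => Q.entry T.input (i a, J (i a)) a, fun i' => ⟨hlt i', funext fun a => ?_⟩⟩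
  rw [← entry_input (v := (i', J i')) (hlt i')]
  exact heq i' _ ⟨a, Finset.mem_inter.2 ⟨a.2, hi ⟨a, Q.attr_subset_attrs i' a.2⟩⟩⟩

theorem exists_joins_of_mem_join (hT : Q.Lists T D) (hs : s ∈ Q.join D) : ∃ J, Joins T J s := by
  refine ⟨fun i => (T i).idxOf (proj (Q.attr_subset_attrs i) s), fun i => ?_⟩
  have hmem : proj (Q.attr_subset_attrs i) s ∈ T i := by
    rw [← List.mem_toFinset, (hT i).2]
    exact hs i
  have hlt := List.idxOf_lt_length_iff.2 hmem
  exact ⟨hlt, by rw [List.getD_eq_getElem _ _ hlt, List.getElem_idxOf]⟩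

theorem Joins.mem_join_iff (hs : Joins T J s) :
    s ∈ Q.join D ↔ ∀ i, (T i).getD (J i) 0 ∈ D i :=
  forall_congr' fun i => by rw [(hs i).2]

theorem Joins.eq_of_proj_eq (hT : Q.Lists T D) (hs : Joins T J s) (hs' : Joins T J' s')
    (h : proj (Q.attr_subset_attrs i) s = proj (Q.attr_subset_attrs i) s') : J i = J' i :=
  hT.getD_inj (hs i).1 (hs' i).1 (by rw [(hs i).2, (hs' i).2, h])

theorem Joins.output_eq_iff (hs : Joins T J s) (hs' : Joins T J' s') :
    (Q.hypergraph hi₀ T.input).output J = (Q.hypergraph hi₀ T.input).output J' ↔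
      proj Q.head_subset_attrs s = proj Q.head_subset_attrs s' := by
  refine ⟨fun h => funext fun a => ?_, fun h => funext fun i => funext fun a => ?_⟩
  · obtain ⟨i, -, hi⟩ := Finset.mem_biUnion.1 (Q.head_subset_attrs a.2)
    have hentry := congrFun (congrFun h i) ⟨a, Finset.mem_inter.2 ⟨hi, a.2⟩⟩
    exact (hs.entry_eq ⟨a, Q.head_subset_attrs a.2⟩ hi).symm.trans
      (hentry.trans (hs'.entry_eq ⟨a, Q.head_subset_attrs a.2⟩ hi))
  · obtain ⟨hi, ha⟩ := Finset.mem_inter.1 a.2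
    exact (hs.entry_eq ⟨a, Q.head_subset_attrs ha⟩ hi).trans
      ((congrFun h ⟨a, ha⟩).trans (hs'.entry_eq _ hi).symm)

theorem exists_joins_of_isWitness (hT : Q.Lists T D) (hD' : Q.IsWitness D D')
    (hs : Joins T J s) : ∃ J' s', Joins T J' s' ∧ s' ∈ Q.join D' ∧
      proj Q.head_subset_attrs s' = proj Q.head_subset_attrs s := by
  have hmem : proj Q.head_subset_attrs s ∈ Q.result D' := by
    rw [hD'.2]
    exact ⟨s, hs.mem_join_iff.2 fun i => hT.getD_mem (hs i).1, rfl⟩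
  obtain ⟨s', hs', heq⟩ := hmem
  obtain ⟨J', hJ'⟩ := exists_joins_of_mem_join hT fun i => hD'.1 i (hs' i)
  exact ⟨J', s', hJ', hs', heq⟩

theorem mem_head_of_ne (hβ : Q.nonOutput = {β}) {a : ℕ} (ha : a ∈ Q.attrs) (h : a ≠ β) :
    a ∈ Q.head := by
  by_contra hh
  exact h (Finset.mem_singleton.1 (hβ ▸ Finset.mem_sdiff.2 ⟨ha, hh⟩))

theorem proj_eq_of_notMem (hβ : Q.nonOutput = {β}) (hi : β ∉ Q.attr i)
    (h : proj Q.head_subset_attrs s = proj Q.head_subset_attrs s') :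
    proj (Q.attr_subset_attrs i) s = proj (Q.attr_subset_attrs i) s' :=
  funext fun a => congrFun h ⟨a, mem_head_of_ne hβ (Q.attr_subset_attrs i a.2)
    fun ha => hi (ha ▸ a.2)⟩

end Joins

section Correctness

variable {Q : CQ} {β : ℕ} {i₀ : Fin Q.numRels} {hi₀ : β ∈ Q.attr i₀} {T : Q.Tables}
  {D D' : Q.Database}

theorem unambiguous_hypergraph (hβ : Q.nonOutput = {β}) (hT : Q.Lists T D) :
    (Q.hypergraph hi₀ T.input).Unambiguous := by
  intro J hJ J' hJ' v hv w hw hcol hout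
  obtain ⟨s, hs⟩ := exists_joins_of_mem_edges hJ
  obtain ⟨s', hs'⟩ := exists_joins_of_mem_edges hJ'
  obtain ⟨i, j⟩ := v
  obtain ⟨i', j'⟩ := w
  obtain ⟨hi, hj : J i = j⟩ := (mem_ends_iff hi₀).1 hv
  obtain ⟨hi', hj' : J' i' = j'⟩ := (mem_ends_iff hi₀).1 hw
  subst hj hj'
  have hβs : s ⟨β, Q.attr_subset_attrs i hi⟩ = s' ⟨β, Q.attr_subset_attrs i hi⟩ :=
    (hs.entry_eq _ hi).symm.trans (hcol.trans (hs'.entry_eq ⟨β, Q.attr_subset_attrs i hi⟩ hi'))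
  have heq : s = s' := by
    funext ⟨a, ha⟩
    by_cases haβ : a = β
    · subst haβ
      exact hβs
    · exact congrFun ((hs.output_eq_iff hi₀ hs').1 hout) ⟨a, mem_head_of_ne hβ ha haβ⟩
  exact funext fun i => hs.eq_of_proj_eq hT hs' (heq ▸ rfl)

theorem exists_mem_seeds (I : Input Q.numRels) :
    ∀ J ∈ Q.edges I, ∃ v ∈ Q.seeds I i₀, v ∈ (Q.hypergraph hi₀ I).ends J := fun J hJ =>
  ⟨(i₀, J i₀), List.mem_map_of_mem (List.mem_range.2 (Finset.mem_range.1
    (Fintype.mem_piFinset.1 (mem_piFinset_of_mem_edges hJ) i₀))), (mem_ends_iff hi₀).2 ⟨hi₀, rfl⟩⟩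

theorem card_ends_le (I : Input Q.numRels) (J : Fin Q.numRels → ℕ) :
    ((Q.hypergraph hi₀ I).ends J).card ≤ Q.numRels :=
  Finset.card_image_le.trans ((Finset.card_filter_le _ _).trans_eq (Finset.card_fin _))

theorem card_edges_le_size_pow (I : Input Q.numRels) :
    (Q.edges I).card ≤ I.size ^ Q.numRels := by
  refine (Finset.card_filter_le _ _).trans_eq ?_
  rw [Fintype.card_piFinset_const, Finset.card_range]

theorem log_card_edges_le (I : Input Q.numRels) :
    Real.log (Q.edges I).card ≤ Q.numRels * Real.log I.size := by
  rcases Nat.eq_zero_or_pos (Q.edges I).card with h | hpos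
  · rw [h, Nat.cast_zero, Real.log_zero]
    exact mul_nonneg (Nat.cast_nonneg _) (Real.log_natCast_nonneg _)
  · rw [← Real.log_pow]
    exact Real.log_le_log (by exact_mod_cast hpos) (by exact_mod_cast card_edges_le_size_pow I)

variable (hi₀) in
theorem covers_chosen (I : Input Q.numRels) :
    (Q.hypergraph hi₀ I).Covers (Q.chosen hi₀ I) :=
  ColoredHypergraph.covers_greedy (exists_mem_seeds I) (card_edges_le_size_pow I)

theorem lt_length_of_mem_kept {v : Fin Q.numRels × ℕ} (hv : v ∈ Q.kept hi₀ T.input) :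
    v.2 < (T v.1).length :=
  (Finset.mem_filter.1 hv).2.1

theorem isWitness_kept (hT : Q.Lists T D) :
    Q.IsWitness D (T.select (Q.kept hi₀ T.input)).database := by
  have hsub := database_select_subset hT (Q.kept hi₀ T.input)
  refine ⟨hsub, (Set.image_mono fun _ (hs : _ ∈ Q.join _) i => hsub i (hs i)).antisymm ?_⟩
  rintro _ ⟨s, hs, rfl⟩
  obtain ⟨J, hJ⟩ := exists_joins_of_mem_join hT hs
  obtain ⟨J', hJ'mem, hout, hends⟩ := covers_chosen hi₀ T.input J hJ.mem_edges
  obtain ⟨s', hs'⟩ := exists_joins_of_mem_edges hJ'mem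
  refine ⟨s', hs'.mem_join_iff.2 fun i => mem_database_select.2 ⟨J' i, (hs' i).1, ?_, rfl⟩,
    (hs'.output_eq_iff hi₀ hJ).1 hout⟩
  refine Finset.mem_filter.2 ⟨Input.mem_rows.2 ((hs' i).1.trans_le (length_le_size_input T i)),
    (hs' i).1, ?_⟩
  split_ifs with hi
  · exact (ends_subset_iff hi₀).1 hends ⟨i, hi⟩
  · exact ⟨J', hJ'mem, rfl⟩

theorem card_kept_le (hβ : Q.nonOutput = {β}) (hT : Q.Lists T D) (hD' : Q.IsWitness D D')
    (i : Fin Q.numRels) : ((T.select (Q.kept hi₀ T.input)).database i).card ≤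
      {v ∈ Q.chosen hi₀ T.input | v.1 = i}.card + (D' i).card := by
  by_cases hi : β ∈ Q.attr i
  · refine le_add_right ((Finset.card_le_card fun t ht => ?_).trans
      (Finset.card_image_le (f := fun v : Fin Q.numRels × ℕ => (T i).getD v.2 0)))
    obtain ⟨j, -, hj, rfl⟩ := mem_database_select.1 ht
    have hmem := (Finset.mem_filter.1 hj).2.2
    rw [if_pos hi] at hmem
    exact Finset.mem_image.2 ⟨(i, j), Finset.mem_filter.2 ⟨hmem, rfl⟩, rfl⟩
  · refine le_add_left (Finset.card_le_card fun t ht => ?_)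
    obtain ⟨j, -, hj, rfl⟩ := mem_database_select.1 ht
    have hmem := (Finset.mem_filter.1 hj).2.2
    rw [if_neg hi] at hmem
    obtain ⟨J, hJ, hJi : J i = j⟩ := hmem
    obtain ⟨s, hs⟩ := exists_joins_of_mem_edges hJ
    obtain ⟨J', s', -, hs'mem, heq⟩ := exists_joins_of_isWitness hT hD' hs
    rw [← hJi, (hs i).2, ← proj_eq_of_notMem hβ hi heq]
    exact hs'mem i

theorem size_kept_le (hβ : Q.nonOutput = {β}) (hT : Q.Lists T D) (hD' : Q.IsWitness D D') :
    (T.select (Q.kept hi₀ T.input)).database.size ≤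
      (Q.chosen hi₀ T.input).card + D'.size := by
  rw [Finset.card_eq_sum_card_fiberwise (f := Prod.fst) (t := Finset.univ)
    fun _ _ => Finset.mem_coe.2 (Finset.mem_univ _), Database.size, Database.size,
    ← Finset.sum_add_distrib]
  exact Finset.sum_le_sum fun i _ => card_kept_le hβ hT hD' i

/-- The rows of the tables `T` that hold the tuples of the sub-database `D`. -/
def rowsOf (T : Q.Tables) (D : Q.Database) : Rows Q.numRels :=
  (Finset.univ.sigma D).image fun t => (t.1, (T t.1).idxOf t.2)

theorem card_rowsOf_le (T : Q.Tables) (D : Q.Database) : (rowsOf T D).card ≤ D.size :=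
  Finset.card_image_le.trans_eq (Finset.card_sigma _ _)

theorem rowsOf_subset (hT : Q.Lists T D) (hD' : ∀ i, D' i ⊆ D i) :
    rowsOf T D' ⊆ T.input.rows := by
  refine Finset.image_subset_iff.2 fun ⟨i, t⟩ ht => Input.mem_rows.2 ?_
  have hmem : t ∈ T i := by
    rw [← List.mem_toFinset, (hT i).2]
    exact hD' i (Finset.mem_sigma.1 ht).2
  exact (List.idxOf_lt_length_iff.2 hmem).trans_le (length_le_size_input T i)

theorem covers_rowsOf (hT : Q.Lists T D) (hD' : Q.IsWitness D D') :
    (Q.hypergraph hi₀ T.input).Covers (rowsOf T D') := by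
  intro J hJ
  obtain ⟨s, hs⟩ := exists_joins_of_mem_edges hJ
  obtain ⟨J', s', hs', hs'mem, heq⟩ := exists_joins_of_isWitness hT hD' hs
  refine ⟨J', hs'.mem_edges, (hs'.output_eq_iff hi₀ hs).2 heq, (ends_subset_iff hi₀).2 fun i => ?_⟩
  refine Finset.mem_image.2 ⟨⟨i, (T i).getD (J' i) 0⟩, Finset.mem_sigma.2
    ⟨Finset.mem_univ _, hs'.mem_join_iff.1 hs'mem i⟩, ?_⟩
  rw [hT.idxOf_getD (hs' i).1]

theorem card_chosen_le (hβ : Q.nonOutput = {β}) (hT : Q.Lists T D) (hD' : Q.IsWitness D D') :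
    ((Q.chosen hi₀ T.input).card : ℝ) ≤
      Q.numRels * (1 + Q.numRels * Real.log D.size) * D'.size := by
  calc ((Q.chosen hi₀ T.input).card : ℝ)
      ≤ Q.numRels * (1 + Real.log (Q.edges T.input).card) * (rowsOf T D').card :=
        ColoredHypergraph.card_greedy_le (unambiguous_hypergraph hβ hT)
          (fun J _ => card_ends_le T.input J) (exists_mem_seeds T.input)
          (card_edges_le_size_pow T.input) (rowsOf_subset hT hD'.1) (covers_rowsOf hT hD')
    _ ≤ Q.numRels * (1 + Q.numRels * Real.log D.size) * D'.size := by
        rw [hT.size_eq]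
        gcongr
        · exact log_card_edges_le T.input
        · exact card_rowsOf_le T D'

/-- The approximation ratio of the greedy algorithm for `k` relations and `N` tuples. -/
noncomputable def ratio (k N : ℕ) : ℝ := k * (1 + k * Real.log N) + 1

theorem ratio_isBigO (k : ℕ) : ratio k =O[atTop] fun N : ℕ => Real.log (N : ℝ) := by
  have hconst : (fun _ : ℕ => (k + 1 : ℝ)) =O[atTop] fun N : ℕ => Real.log (N : ℝ) :=
    (Real.isLittleO_const_log_atTop.comp_tendsto tendsto_natCast_atTop_atTop).isBigO
  refine (hconst.add ((isBigO_refl _ _).const_mul_left (k * k : ℝ))).congr_left fun N => ?_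
  rw [ratio]
  ring

theorem isApproxSmallestWitness_kept (hβ : Q.nonOutput = {β}) (hT : Q.Lists T D) :
    Q.IsApproxSmallestWitness (ratio Q.numRels D.size) D
      (T.select (Q.kept hi₀ T.input)).database := by
  refine ⟨isWitness_kept hT, fun Dstar hD => ?_⟩
  calc ((T.select (Q.kept hi₀ T.input)).database.size : ℝ)
      ≤ (Q.chosen hi₀ T.input).card + Dstar.size := by exact_mod_cast size_kept_le hβ hT hD.1
    _ ≤ Q.numRels * (1 + Q.numRels * Real.log D.size) * Dstar.size + Dstar.size := by
        gcongr
        exact card_chosen_le hβ hT hD.1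
    _ = ratio Q.numRels D.size * Dstar.size := by
        rw [ratio]
        ring

variable (hi₀) in
theorem exists_prog_outputs_kept : ∃ (P : Prog) (p : Polynomial ℕ), ∀ T : Q.Tables,
    ∃ n s, Exec P (Q.inputState T) n s ∧ n ≤ p.eval T.input.size ∧
      Q.Outputs s (T.select (Q.kept hi₀ T.input)) := by
  obtain ⟨P, p, h⟩ := (PolyCmd.letSet (polySet_kept (hi₀ := hi₀))
    (G := fun I _ _ S => I.compact (fun i => (Q.attr i).card) S)
    (PolyCmd.compact (fun i => (Q.attr i).card) none)).exists_runs
  refine ⟨P, p, fun T => ?_⟩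
  obtain ⟨n, s, hexec, hn, hs⟩ := h (Q.inputState T)
  have hsize : ∑ i : Fin Q.numRels, (Q.inputState T).reg i = T.input.size :=
    congrArg Input.size (totalInput_inputState T)
  rw [totalInput_inputState] at hs
  refine ⟨n, s, hexec, hsize ▸ hn, outputs_select (fun _ => lt_length_of_mem_kept) fun i => ?_⟩
  rw [hs]
  exact T.input.isCompaction_compact _ _ i

theorem swpApproximable_ratio (hβ : Q.nonOutput = {β}) (hi₀ : β ∈ Q.attr i₀) :
    Q.SWPApproximable (ratio Q.numRels) := by
  obtain ⟨P, p, h⟩ := exists_prog_outputs_kept hi₀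
  refine ⟨P, p, fun D T hT => ?_⟩
  obtain ⟨n, s, hexec, hn, hout⟩ := h T
  exact ⟨n, s, _, _, hexec, hT.size_eq ▸ hn, hout, hT.select _,
    isApproxSmallestWitness_kept hβ hT⟩

end Correctness

end CQ

theorem mainTheorem4 (Q : CQ) (hQ : Q.nonOutput.card = 1) :
    ∃ θ : ℕ → ℝ, θ =O[atTop] (fun N : ℕ => Real.log (N : ℝ)) ∧ Q.SWPApproximable θ := by
  obtain ⟨β, hβ⟩ := Finset.card_eq_one.1 hQ
  have hβmem : β ∈ Q.nonOutput := hβ ▸ Finset.mem_singleton_self β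
  obtain ⟨i₀, -, hi₀⟩ := Finset.mem_biUnion.1 (Finset.mem_sdiff.1 hβmem).1
  exact ⟨CQ.ratio Q.numRels, CQ.ratio_isBigO Q.numRels, CQ.swpApproximable_ratio hβ hi₀⟩
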